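/- Let $G=(V,E)$ be a finite undirected graph (loops and multiple edges allowed) and let $A,B\subseteq V^2$. A *fourientation* $\phi$ of $G$ gives each edge (including loops) one of four configurations: 0-way (not traversable), 1-way (traversable in only one of its two directions), or 2-way (traversable in both directions). The *solid* edges of $\phi$ are the 0-way and the 2-way edges. Let $\vec G(A,B;\phi)$ be the digraph on $V$ whose arcs are the permitted traversals of the edges in $\phi$ together with the pairs in $A$ and $B$ as additional arcs. The fourientation $\phi$ is *$(A,B)$-valid* if in $\vec G(A,B;\phi)$ the vertex $v$ cannot reach $u$ by a directed path for all $(u,v)\in A$, and $v$ can reach $u$ for all $(u,v)\in B$ (paths of length $0$ are allowed). A *directed cycle* of $\phi$ is a cycle of $G$ that can be traversed in one direction using only traversals permitted by $\phi$. An *$(A,B)$-cocycle* is a non-empty set of edges of the form $\{e\in E: e \text{ has one end in } V_1 \text{ and the other in } V_2\}$ for a partition $V=V_1\sqcup V_2$ such that no pair in $A\cup B$ has one element in $V_1$ and the other in $V_2$; it is *directed* in $\phi$ if, for some such partition defining it, no edge can be traversed from $V_2$ to $V_1$ in $\phi$. Reversing a directed cycle (resp. directed $(A,B)$-cocycle)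 of $\phi$ means reversing all the 1-way edges in it and leaving all other edges unchanged. Two fourientations are *cycle equivalent* (resp. *cocycle equivalent*, *cycle-cocycle equivalent*) if one can be obtained from the other by repeatedly reversing directed cycles (resp. directed $(A,B)$-cocycles, directed cycles and/or directed $(A,B)$-cocycles). For $S\subseteq E$, let - $\mathrm{Four}_{G,S}(A,B)/\mathrm{cyc}$ be the set of cycle equivalence classes of $(A,B)$-valid fourientations with set of solid edges $S$ that contain no cycle of $G$ made entirely of 2-way edges; - $\mathrm{Four}_{G,S}(A,B)/\mathrm{coc}$ be the set of cocycle equivalence classes of $(A,B)$-valid fourientations with set of solid edges $S$ that contain no $(A,B)$-cocycle made entirely of 0-way edges; - $\mathrm{Four}_{G,S}(A,B)/\mathrm{cc}$ be the set of cycle-cocycle equivalence classes of $(A,B)$-valid fourientations with set of solid edges $S$ that contain neither a cycle of $G$ made entirely of 2-way edges nor an $(A,B)$-cocycle made entirely of 0-way edges. Then: (i) $|\mathrm{Four}_{G,S}(A,B)/\mathrm{cyc}|$ is independent of $S\subseteq E$; (ii) $|\mathrm{Four}_{G,S}(A,B)/\mathrm{coc}|$ is independent of $S\subseteq E$; (iii)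 $|\mathrm{Four}_{G,S}(A,B)/\mathrm{cc}|$ is independent of $S\subseteq E$. -/

import Mathlib

open scoped Graph

namespace Fourient

variable {α β : Type*}

/-- A conventional orientation of a multigraph (loops and multiple edges are allowed): every
edge `e` gets a conventional direction, from `tail e` to `head e`. -/
structure RefOrientation (G : Graph α β) where
  tail : E(G) → V(G)
  head : E(G) → V(G)
  isLink : ∀ e : E(G), G.IsLink e (tail e) (head e)

/-- The four configurations of an edge: not traversable, traversable only in the conventional
direction, only in the opposite direction, or in both directions. -/
inductive Config
  | zeroWay
  | forward
  | backward
  | twoWay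
  deriving DecidableEq

/-- `c.Allows d`: an edge with configuration `c` can be traversed in the conventional direction
(`d = true`), resp. in the opposite direction (`d = false`). -/
def Config.Allows : Config → Bool → Prop
  | .zeroWay, _ => False
  | .forward, d => d = true
  | .backward, d => d = false
  | .twoWay, _ => True

/-- Reversing an edge swaps the two 1-way configurations and keeps the 0-way and 2-way ones. -/
def Config.reverse : Config → Config
  | .zeroWay => .zeroWay
  | .forward => .backward
  | .backward => .forward
  | .twoWay => .twoWay

/-- A fourientation assigns one of four configurations to each edge (loops included). -/
abbrev Fourientation (G : Graph α β) := E(G) → Config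

/-- The arcs of the digraph in which each edge is replaced by two opposite arcs: `(e, true)` is
`e` in its conventional direction and `(e, false)` is `e` in the opposite direction. -/
abbrev Arc (G : Graph α β) := E(G) × Bool

variable {G : Graph α β}

namespace RefOrientation

/-- Initial vertex of an arc. -/
def src (D : RefOrientation G) (a : Arc G) : V(G) := if a.2 then D.tail a.1 else D.head a.1

/-- Terminal vertex of an arc. -/
def tgt (D : RefOrientation G) (a : Arc G) : V(G) := if a.2 then D.head a.1 else D.tail a.1

/-- Adjacency in the digraph obtained from the digraph of `φ` by adding the arcs in `A` and
`B`. -/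
def Adj (D : RefOrientation G) (A B : Set (V(G) × V(G))) (φ : Fourientation G)
    (u v : V(G)) : Prop :=
  (∃ a : Arc G, (φ a.1).Allows a.2 ∧ D.src a = u ∧ D.tgt a = v) ∨ (u, v) ∈ A ∨ (u, v) ∈ B

/-- `u` can reach `v` by a directed path, in the digraph of `φ` with the arcs in `A` and `B`
added. -/
def Reach (D : RefOrientation G) (A B : Set (V(G) × V(G))) (φ : Fourientation G) :
    V(G) → V(G) → Prop :=
  Relation.ReflTransGen (D.Adj A B φ)

/-- `(A,B)`-valid fourientations. -/
def Valid (D : RefOrientation G) (A B : Set (V(G) × V(G))) (φ : Fourientation G) : Prop :=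
  (∀ u v, (u, v) ∈ A → ¬ D.Reach A B φ v u) ∧ (∀ u v, (u, v) ∈ B → D.Reach A B φ v u)

end RefOrientation

/-- The solid edges of a fourientation: the 0-way and the 2-way ones. -/
def solid (φ : Fourientation G) : Set E(G) := {e | φ e = .zeroWay ∨ φ e = .twoWay}

/-- Reverse all the 1-way edges in `F`; all other edges are left unchanged. -/
noncomputable def reverseOn (F : Set E(G)) (φ : Fourientation G) : Fourientation G :=
  open Classical in fun e => if e ∈ F then (φ e).reverse else φ e

namespace RefOrientation

/-- A cycle of the graph (with a direction of traversal): arcs `c 0, …, c k`, each ending where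
the next one starts and `c k` ending where `c 0` starts (addition in `Fin (k + 1)` is cyclic),
without repeated vertices or edges. A loop is a cycle of length one, and two parallel edges
form a cycle of length two. -/
structure IsCycle (D : RefOrientation G) {k : ℕ} (c : Fin (k + 1) → Arc G) : Prop where
  closed : ∀ i, D.tgt (c i) = D.src (c (i + 1))
  vertices : Function.Injective fun i => D.src (c i)
  edges : Function.Injective fun i => (c i).1

/-- `ψ` is obtained from `φ` by reversing a directed cycle of `φ`. -/
def CycleStep (D : RefOrientation G) (φ ψ : Fourientation G) : Prop :=
  ∃ (k : ℕ) (c : Fin (k + 1) → Arc G), D.IsCycle c ∧ (∀ i, (φ (c i).1).Allows (c i).2) ∧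
    ψ = reverseOn (Set.range fun i => (c i).1) φ

/-- Some cycle of the graph is made entirely of 2-way edges of `φ`. -/
def HasTwoWayCycle (D : RefOrientation G) (φ : Fourientation G) : Prop :=
  ∃ (k : ℕ) (c : Fin (k + 1) → Arc G), D.IsCycle c ∧ ∀ i, φ (c i).1 = .twoWay

/-- The edges of the graph having one end in `U` and the other end outside of `U`. -/
def cut (D : RefOrientation G) (U : Set V(G)) : Set E(G) :=
  {e | ¬ (D.tail e ∈ U ↔ D.head e ∈ U)}

/-- The partition `(U, Uᶜ)` of the vertices defines a (non-empty) cocycle of the graph, and the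
arcs in `A ∪ B` do not cross it. -/
def IsABCut (D : RefOrientation G) (A B : Set (V(G) × V(G))) (U : Set V(G)) : Prop :=
  (D.cut U).Nonempty ∧ ∀ u v, (u, v) ∈ A ∪ B → (u ∈ U ↔ v ∈ U)

/-- `ψ` is obtained from `φ` by reversing a directed `(A,B)`-cocycle of `φ`: the cut of a
partition `(U, Uᶜ)` crossed by no arc in `A ∪ B`, such that no arc of `φ` goes from `Uᶜ`
to `U`. -/
def CocycleStep (D : RefOrientation G) (A B : Set (V(G) × V(G)))
    (φ ψ : Fourientation G) : Prop :=
  ∃ U : Set V(G), D.IsABCut A B U ∧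
    (∀ a : Arc G, (φ a.1).Allows a.2 → D.src a ∉ U → D.tgt a ∉ U) ∧
    ψ = reverseOn (D.cut U) φ

/-- Some `(A,B)`-cocycle is made entirely of 0-way edges of `φ`. -/
def HasZeroWayCocycle (D : RefOrientation G) (A B : Set (V(G) × V(G)))
    (φ : Fourientation G) : Prop :=
  ∃ U : Set V(G), D.IsABCut A B U ∧ ∀ e ∈ D.cut U, φ e = .zeroWay

/-- Cycle equivalence: reachability by repeated reversals of directed cycles. -/
def CycleEquiv (D : RefOrientation G) : Fourientation G → Fourientation G → Prop :=
  Relation.ReflTransGen D.CycleStep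

/-- Cocycle equivalence: reachability by repeated reversals of directed `(A,B)`-cocycles. -/
def CocycleEquiv (D : RefOrientation G) (A B : Set (V(G) × V(G))) :
    Fourientation G → Fourientation G → Prop :=
  Relation.ReflTransGen (D.CocycleStep A B)

/-- Cycle-cocycle equivalence: reachability by repeated reversals of directed cycles and/or
directed `(A,B)`-cocycles. -/
def CycleCocycleEquiv (D : RefOrientation G) (A B : Set (V(G) × V(G))) :
    Fourientation G → Fourientation G → Prop :=
  Relation.ReflTransGen fun φ ψ => D.CycleStep φ ψ ∨ D.CocycleStep A B φ ψ

/-- `(A,B)`-valid fourientations with set of solid edges `S`. -/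
def four (D : RefOrientation G) (A B : Set (V(G) × V(G))) (S : Set E(G)) :
    Set (Fourientation G) :=
  {φ | D.Valid A B φ ∧ solid φ = S}

/-- The cycle equivalence classes of `(A,B)`-valid fourientations with solid set `S` containing
no cycle made entirely of 2-way edges. -/
def cycClasses (D : RefOrientation G) (A B : Set (V(G) × V(G))) (S : Set E(G)) :
    Set (Set (Fourientation G)) :=
  {C | (∃ φ, C = {ψ | D.CycleEquiv φ ψ}) ∧
    ∀ φ ∈ C, φ ∈ D.four A B S ∧ ¬ D.HasTwoWayCycle φ}

/-- The cocycle equivalence classes of `(A,B)`-valid fourientations with solid set `S`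
containing no `(A,B)`-cocycle made entirely of 0-way edges. -/
def cocClasses (D : RefOrientation G) (A B : Set (V(G) × V(G))) (S : Set E(G)) :
    Set (Set (Fourientation G)) :=
  {C | (∃ φ, C = {ψ | D.CocycleEquiv A B φ ψ}) ∧
    ∀ φ ∈ C, φ ∈ D.four A B S ∧ ¬ D.HasZeroWayCocycle A B φ}

/-- The cycle-cocycle equivalence classes of `(A,B)`-valid fourientations with solid set `S`
containing no cycle made entirely of 2-way edges and no `(A,B)`-cocycle made entirely of 0-way
edges. -/
def ccClasses (D : RefOrientation G) (A B : Set (V(G) × V(G))) (S : Set E(G)) :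
    Set (Set (Fourientation G)) :=
  {C | (∃ φ, C = {ψ | D.CycleCocycleEquiv A B φ ψ}) ∧
    ∀ φ ∈ C, φ ∈ D.four A B S ∧ ¬ D.HasTwoWayCycle φ ∧ ¬ D.HasZeroWayCocycle A B φ}

end RefOrientation

end Fourient

/-!
A configuration is a pair of permissions, one for each direction of the edge, and the edge is solid
when the two agree. So toggling one permission of an edge `e` replaces the solid set `S` by
`S ∆ {e}`. If one end of `e` reaches the other one without using `e`, then the permission of `e` in
this direction has no influence on reachability; if neither end reaches the other, then no
configuration of `e` has an influence on validity, because a path through `e` between the ends of a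
pair in `A` or `B` would close up with this pair. So one of the two toggles always preserves
validity, and toggling in this direction is an involution, as the direction depends on the other
edges only.

To count classes, choose a representative in each of them. For cocycle equivalence it is the
fourientation in which every vertex can be reached from the root of its component; this is again a
validity condition. For cycle equivalence it is the one in which, for a linear order of the edges,
the least 1-way edge of each directed cycle has its conventional direction; when `e` is the largest
edge, the choice of a toggle can be made to respect this condition as well. As reversals of directed
cycles and of directed cocycles commute, the two choices together give representatives for
cycle-cocycle equivalence.
-/

namespace Fourient

open Relation

variable {α β : Type*} {G : Graph α β}

/-! ### Toggling an edge and validity -/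

namespace Arc

/-- The arc on the same edge in the opposite direction. -/
def rev (a : Arc G) : Arc G := (a.1, !a.2)

@[simp] theorem rev_fst (a : Arc G) : a.rev.1 = a.1 := rfl

@[simp] theorem rev_snd (a : Arc G) : a.rev.2 = !a.2 := rfl

theorem eq_or_eq_rev {a b : Arc G} (h : a.1 = b.1) : a = b ∨ a = b.rev := by
  obtain ⟨e, d⟩ := a
  obtain ⟨e', d'⟩ := b
  obtain rfl : e = e' := h
  cases d <;> cases d' <;> simp [rev]

end Arc

namespace RefOrientation

variable (D : RefOrientation G)

@[simp] theorem src_rev (a : Arc G) : D.src a.rev = D.tgt a := by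
  obtain ⟨e, _ | _⟩ := a <;> rfl

@[simp] theorem tgt_rev (a : Arc G) : D.tgt a.rev = D.src a := by
  obtain ⟨e, _ | _⟩ := a <;> rfl

@[simp] theorem src_true (e : E(G)) : D.src (e, true) = D.tail e := rfl

@[simp] theorem src_false (e : E(G)) : D.src (e, false) = D.head e := rfl

@[simp] theorem tgt_true (e : E(G)) : D.tgt (e, true) = D.head e := rfl

@[simp] theorem tgt_false (e : E(G)) : D.tgt (e, false) = D.tail e := rfl

end RefOrientation

/-- The arcs along which `φ` may be traversed. -/
def arcs (φ : Fourientation G) : Set (Arc G) := {a | (φ a.1).Allows a.2}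

@[simp] theorem mem_arcs {φ : Fourientation G} {a : Arc G} :
    a ∈ arcs φ ↔ (φ a.1).Allows a.2 := Iff.rfl

namespace Config

@[simp] theorem not_allows_zeroWay (d : Bool) : ¬ zeroWay.Allows d := id

@[simp] theorem allows_twoWay (d : Bool) : twoWay.Allows d := trivial

/-- Flip the permission to traverse an edge in direction `d`. A configuration is a pair of
permissions, one for each direction, and an edge is solid when the two agree; so this turns solid
edges into 1-way edges and conversely. -/
def toggle : Bool → Config → Config
  | true, zeroWay => forward
  | true, forward => zeroWay
  | true, backward => twoWay
  | true, twoWay => backward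
  | false, zeroWay => backward
  | false, forward => twoWay
  | false, backward => zeroWay
  | false, twoWay => forward

@[simp] theorem toggle_toggle (d : Bool) (c : Config) : (c.toggle d).toggle d = c := by
  cases d <;> cases c <;> rfl

theorem allows_toggle_not (d : Bool) (c : Config) :
    (c.toggle d).Allows (!d) ↔ c.Allows (!d) := by
  cases d <;> cases c <;> simp [toggle, Allows]

theorem toggle_eq_zeroWay_or_eq_twoWay (d : Bool) (c : Config) :
    c.toggle d = zeroWay ∨ c.toggle d = twoWay ↔ ¬ (c = zeroWay ∨ c = twoWay) := by
  cases d <;> cases c <;> simp [toggle]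

end Config

/-- Flipping the permission of `e` in direction `d` never affects whether `P` holds, whatever the
configuration of `e`, the other edges being configured as in `φ`. -/
def ToggleInvariant [DecidableEq E(G)] (P : Fourientation G → Prop) (φ : Fourientation G)
    (e : E(G)) (d : Bool) : Prop :=
  ∀ c : Config, P (Function.update φ e (c.toggle d)) ↔ P (Function.update φ e c)

section ToggleInvariant

variable [DecidableEq E(G)] {P Q : Fourientation G → Prop} {φ : Fourientation G} {e : E(G)}

theorem ToggleInvariant.and {d : Bool} (hP : ToggleInvariant P φ e d)
    (hQ : ToggleInvariant Q φ e d) : ToggleInvariant (fun ψ => P ψ ∧ Q ψ) φ e d :=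
  fun c => and_congr (hP c) (hQ c)

theorem toggleInvariant_of_forall_iff {p : Prop} (h : ∀ c, P (Function.update φ e c) ↔ p)
    (d : Bool) : ToggleInvariant P φ e d :=
  fun c => (h _).trans (h c).symm

end ToggleInvariant

namespace RefOrientation

variable {D : RefOrientation G}

section ReachVia

variable (D) in
/-- Adjacency through an arc in `T` or a pair in `P`. -/
def StepVia (P : Set (V(G) × V(G))) (T : Set (Arc G)) (u v : V(G)) : Prop :=
  (∃ a ∈ T, D.src a = u ∧ D.tgt a = v) ∨ (u, v) ∈ P

variable (D) in
/-- `u` can reach `v` by a directed path made of arcs in `T` and pairs in `P`. -/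
def ReachVia (P : Set (V(G) × V(G))) (T : Set (Arc G)) : V(G) → V(G) → Prop :=
  ReflTransGen (D.StepVia P T)

variable {P P' : Set (V(G) × V(G))} {T T' : Set (Arc G)} {u v : V(G)}

theorem stepVia_of_mem {a : Arc G} (ha : a ∈ T) : D.StepVia P T (D.src a) (D.tgt a) :=
  .inl ⟨a, ha, rfl, rfl⟩

theorem ReachVia.mono (hP : P ⊆ P') (hT : T ⊆ T') (h : D.ReachVia P T u v) :
    D.ReachVia P' T' u v :=
  ReflTransGen.mono (fun _ _ => Or.imp (fun ⟨a, ha, h⟩ => ⟨a, hT ha, h⟩) (@hP _)) _ _ h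

theorem ReachVia.symm (hT : ∀ a ∈ T, a.rev ∈ T) (h : D.ReachVia ∅ T u v) :
    D.ReachVia ∅ T v u := by
  refine reflTransGen_swap.1 (ReflTransGen.mono ?_ _ _ h)
  rintro _ _ (⟨a, ha, rfl, rfl⟩ | h)
  · exact .inl ⟨a.rev, hT a ha, D.src_rev a, D.tgt_rev a⟩
  · exact h.elim

/-- A path using the edge `e` several times can be shortened so as to use it at most once. -/
theorem reachVia_iff_of_arcs {e : E(G)} (hT : T ⊆ T') (he : ∀ a ∈ T', a.1 ≠ e → a ∈ T) :
    D.ReachVia P T' u v ↔ D.ReachVia P T u v ∨ ∃ d, (e, d) ∈ T' ∧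
      D.ReachVia P T u (D.src (e, d)) ∧ D.ReachVia P T (D.tgt (e, d)) v := by
  constructor
  · intro h
    induction h with
    | refl => exact .inl .refl
    | @tail v w _ hvw ih =>
      by_cases hT' : D.StepVia P T v w
      · exact ih.imp (·.tail hT') fun ⟨d, hd, h₁, h₂⟩ => ⟨d, hd, h₁, h₂.tail hT'⟩
      obtain ⟨⟨e', d⟩, ha, rfl, rfl⟩ | hP := hvw
      · obtain rfl : e' = e := by
          by_contra hne
          exact hT' (stepVia_of_mem (he _ ha hne))
        obtain h | ⟨d', -, h₁, -⟩ := ih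
        · exact .inr ⟨d, ha, h, .refl⟩
        · obtain hdd | hdd := Arc.eq_or_eq_rev (a := (e', d')) (b := (e', d)) rfl
          · exact .inr ⟨d, ha, hdd ▸ h₁, .refl⟩
          · rw [hdd, src_rev] at h₁
            exact .inl h₁
      · exact absurd (.inr hP) hT'
  · rintro (h | ⟨d, hd, h₁, h₂⟩)
    · exact h.mono subset_rfl hT
    · exact ((h₁.mono subset_rfl hT).tail (stepVia_of_mem hd)).trans (h₂.mono subset_rfl hT)

end ReachVia

section Toggle

variable {A B A' B' : Set (V(G) × V(G))} {φ : Fourientation G} {e : E(G)} {u v : V(G)}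

theorem reach_iff_reachVia : D.Reach A B φ u v ↔ D.ReachVia (A ∪ B) (arcs φ) u v := Iff.rfl

theorem Reach.mono_pairs (hAB : A ∪ B ⊆ A' ∪ B') (h : D.Reach A B φ u v) :
    D.Reach A' B' φ u v :=
  ReachVia.mono hAB subset_rfl h

variable [DecidableEq E(G)]

theorem reach_update_iff (hφ : φ e = .zeroWay) (c : Config) :
    D.Reach A B (Function.update φ e c) u v ↔ D.Reach A B φ u v ∨ ∃ d, c.Allows d ∧
      D.Reach A B φ u (D.src (e, d)) ∧ D.Reach A B φ (D.tgt (e, d)) v := by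
  have hsub : arcs φ ⊆ arcs (Function.update φ e c) := by
    intro a ha
    have hae : a.1 ≠ e := by
      rintro rfl
      simp [hφ] at ha
    simpa [hae] using ha
  simp only [reach_iff_reachVia]
  rw [reachVia_iff_of_arcs hsub (e := e) fun a ha hae => by simpa [hae] using ha]
  simp

theorem reach_update_iff_of_reach (hφ : φ e = .zeroWay) {d : Bool}
    (h : D.Reach A B φ (D.src (e, d)) (D.tgt (e, d))) (c : Config) :
    D.Reach A B (Function.update φ e c) u v ↔ D.Reach A B φ u v ∨ c.Allows (!d) ∧
      D.Reach A B φ u (D.src (e, !d)) ∧ D.Reach A B φ (D.tgt (e, !d)) v := by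
  rw [reach_update_iff hφ]
  constructor
  · rintro (h₀ | ⟨d', hd', h₁, h₂⟩)
    · exact .inl h₀
    · obtain rfl | rfl := Bool.eq_or_eq_not d' d
      · exact .inl ((h₁.trans h).trans h₂)
      · exact .inr ⟨hd', h₁, h₂⟩
  · exact Or.imp_right fun h => ⟨!d, h⟩

theorem toggleInvariant_valid_of_reach (hφ : φ e = .zeroWay) {d : Bool}
    (h : D.Reach A B φ (D.src (e, d)) (D.tgt (e, d))) :
    ToggleInvariant (D.Valid A B) φ e d := by
  intro c
  simp only [Valid, reach_update_iff_of_reach hφ h, Config.allows_toggle_not]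

theorem valid_update_iff_of_not_reach (hφ : φ e = .zeroWay)
    (h : ∀ d, ¬ D.Reach A B φ (D.src (e, d)) (D.tgt (e, d))) (c : Config) :
    D.Valid A B (Function.update φ e c) ↔ D.Valid A B φ := by
  -- A path from `v` to `u` through `e` and the pair `(u, v)` form a closed walk, and its part
  -- outside of `e` would lead from one end of `e` to the other.
  have hreach : ∀ u v, (u, v) ∈ A ∪ B →
      (D.Reach A B (Function.update φ e c) v u ↔ D.Reach A B φ v u) := by
    intro u v huv
    rw [reach_update_iff hφ, or_iff_left_iff_imp]
    rintro ⟨d, -, h₁, h₂⟩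
    have hback : ¬ D.Reach A B φ (D.tgt (e, d)) (D.src (e, d)) := by
      rw [← D.src_rev (e, d), ← D.tgt_rev (e, d)]
      exact h !d
    exact absurd ((h₂.tail (.inr huv)).trans h₁) hback
  exact and_congr
    (forall₂_congr fun u v => forall_congr' fun huv => not_congr (hreach u v (.inl huv)))
    (forall₂_congr fun u v => forall_congr' fun huv => hreach u v (.inr huv))

theorem exists_toggleInvariant_valid (hAB : A ∪ B ⊆ A' ∪ B') (hφ : φ e = .zeroWay) :
    ∃ d, ToggleInvariant (D.Valid A B) φ e d ∧ ToggleInvariant (D.Valid A' B') φ e d := by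
  by_cases h : ∃ d, D.Reach A B φ (D.src (e, d)) (D.tgt (e, d))
  · obtain ⟨d, hd⟩ := h
    exact ⟨d, toggleInvariant_valid_of_reach hφ hd,
      toggleInvariant_valid_of_reach hφ (hd.mono_pairs hAB)⟩
  have hconst := toggleInvariant_of_forall_iff
    (valid_update_iff_of_not_reach hφ (not_exists.1 h))
  by_cases h' : ∃ d, D.Reach A' B' φ (D.src (e, d)) (D.tgt (e, d))
  · obtain ⟨d, hd⟩ := h'
    exact ⟨d, hconst d, toggleInvariant_valid_of_reach hφ hd⟩
  · exact ⟨true, hconst true, toggleInvariant_of_forall_iff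
      (valid_update_iff_of_not_reach hφ (not_exists.1 h')) true⟩

end Toggle

end RefOrientation

/-! ### Cycles through an arc -/

theorem exists_injective_path {V : Type*} {r : V → V → Prop} {x y : V}
    (h : ReflTransGen r x y) : ∃ (n : ℕ) (v : Fin (n + 1) → V), Function.Injective v ∧
      v 0 = x ∧ v (Fin.last n) = y ∧ ∀ i : Fin n, r (v i.castSucc) (v i.succ) := by
  induction h with
  | refl =>
    exact ⟨0, fun _ => x, fun i j _ => Subsingleton.elim (α := Fin 1) i j, rfl, rfl,
      fun i => i.elim0⟩
  | @tail y z _ hyz ih =>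
    obtain ⟨n, v, hinj, h₀, rfl, hv⟩ := ih
    by_cases hz : ∃ j, v j = z
    · obtain ⟨j, rfl⟩ := hz
      exact ⟨j, v ∘ Fin.castLE (by omega), hinj.comp (Fin.castLE_injective _), h₀, rfl,
        fun i => hv (i.castLE (by omega))⟩
    · refine ⟨n + 1, Fin.snoc v z, Fin.snoc_injective_iff.2 ⟨hinj, by simpa using hz⟩, ?_,
        Fin.snoc_last _ _, fun i => ?_⟩
      · rw [← Fin.castSucc_zero, Fin.snoc_castSucc, h₀]
      · induction i using Fin.lastCases with
        | last => simpa using hyz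
        | cast i => rw [← Fin.castSucc_succ, Fin.snoc_castSucc, Fin.snoc_castSucc]; exact hv i

theorem reflTransGen_of_cyclic {V : Type*} {r : V → V → Prop} {k : ℕ} {v : Fin (k + 1) → V}
    (h : ∀ i, r (v i) (v (i + 1))) (i j : Fin (k + 1)) : ReflTransGen r (v i) (v j) := by
  suffices ∀ l, ReflTransGen r (v i) (v (i + l)) by simpa using this (j - i)
  intro l
  induction l using Fin.induction with
  | zero => simpa using ReflTransGen.refl
  | succ l ih => simpa [add_assoc, Fin.coeSucc_eq_succ] using ih.tail (h _)

namespace RefOrientation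

variable {D : RefOrientation G}

theorem exists_isCycle_of_reachVia {T : Set (Arc G)} {a : Arc G} (ha : ∀ b ∈ T, b.1 ≠ a.1)
    (h : D.ReachVia ∅ T (D.tgt a) (D.src a)) :
    ∃ (k : ℕ) (c : Fin (k + 1) → Arc G), D.IsCycle c ∧ (∃ i, c i = a) ∧
      ∀ i, c i = a ∨ c i ∈ T := by
  obtain ⟨n, v, hinj, h₀, hn, hv⟩ := exists_injective_path h
  choose s hs hsrc htgt using fun i => (hv i).resolve_right id
  set c : Fin (n + 1) → Arc G := Fin.snoc s a
  have hc (i : Fin n) : c i.castSucc = s i := Fin.snoc_castSucc ..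
  have hca : c (Fin.last n) = a := Fin.snoc_last ..
  have hcv (i : Fin (n + 1)) : D.src (c i) = v i := by
    induction i using Fin.lastCases with
    | last => rw [hca, hn]
    | cast i => rw [hc, hsrc]
  have hsucc (i : Fin n) : D.tgt (c i.castSucc) = v i.succ := by rw [hc, htgt]
  refine ⟨n, c, ⟨fun i => ?_, fun i j hij => hinj (by simpa only [hcv] using hij), ?_⟩,
    ⟨_, hca⟩, fun i => ?_⟩
  · induction i using Fin.lastCases with
    | last => rw [hca, Fin.last_add_one, hcv, h₀]
    | cast i => rw [hsucc, Fin.coeSucc_eq_succ, hcv]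
  · intro i j (hij : (c i).1 = (c j).1)
    induction i using Fin.lastCases with
    | last =>
      induction j using Fin.lastCases with
      | last => rfl
      | cast j => rw [hca, hc] at hij; exact absurd hij.symm (ha _ (hs j))
    | cast i =>
      induction j using Fin.lastCases with
      | last => rw [hca, hc] at hij; exact absurd hij (ha _ (hs i))
      | cast j =>
        obtain h | h := Arc.eq_or_eq_rev hij
        · exact hinj (by rw [← hcv, ← hcv, h])
        · have h₁ := hinj ((hcv _).symm.trans ((congrArg D.src h).trans
            ((D.src_rev _).trans (hsucc j))))
          have h₂ := hinj ((hsucc i).symm.trans ((congrArg D.tgt h).trans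
            ((D.tgt_rev _).trans (hcv _))))
          simp only [Fin.ext_iff, Fin.val_castSucc, Fin.val_succ] at h₁ h₂
          omega
  · induction i using Fin.lastCases with
    | last => exact .inl hca
    | cast i => exact .inr (hc i ▸ hs i)

theorem IsCycle.reachVia {k : ℕ} {c : Fin (k + 1) → Arc G} (hc : D.IsCycle c)
    (i : Fin (k + 1)) :
    D.ReachVia ∅ {b | b ∈ Set.range c ∧ b.1 ≠ (c i).1} (D.tgt (c i)) (D.src (c i)) := by
  have hpath (j : Fin (k + 1)) : D.ReachVia ∅ {b | b ∈ Set.range c ∧ b.1 ≠ (c i).1}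
      (D.tgt (c i)) (D.tgt (c (i + j))) := by
    induction j using Fin.induction with
    | zero => rw [add_zero]; exact .refl
    | succ j ih =>
      rw [hc.closed (i + j.castSucc), add_assoc, Fin.coeSucc_eq_succ] at ih
      refine ih.tail (stepVia_of_mem ⟨⟨_, rfl⟩, fun h => Fin.succ_ne_zero j ?_⟩)
      simpa using hc.edges h
  simpa [hc.closed, add_assoc] using hpath (Fin.last k)

end RefOrientation

/-! ### Cycle-minimal fourientations -/

namespace RefOrientation

variable {D : RefOrientation G} {φ ψ : Fourientation G}

theorem HasTwoWayCycle.mono (hφψ : ∀ e, φ e = .twoWay → ψ e = .twoWay)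
    (h : D.HasTwoWayCycle φ) : D.HasTwoWayCycle ψ :=
  let ⟨k, c, hc, hφ⟩ := h
  ⟨k, c, hc, fun i => hφψ _ (hφ i)⟩

end RefOrientation

/-- The arcs of the 2-way edges of `φ`. -/
def twoWayArcs (φ : Fourientation G) : Set (Arc G) := {a | φ a.1 = .twoWay}

@[simp] theorem mem_twoWayArcs {φ : Fourientation G} {a : Arc G} :
    a ∈ twoWayArcs φ ↔ φ a.1 = .twoWay := Iff.rfl

/-- The arcs of the 2-way edges of `φ` and the permitted arcs of `φ` on edges larger than `m`. -/
def upperArcs [LinearOrder E(G)] (φ : Fourientation G) (m : E(G)) : Set (Arc G) :=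
  {a | φ a.1 = .twoWay ∨ (φ a.1).Allows a.2 ∧ m < a.1}

namespace RefOrientation

variable {D : RefOrientation G} {A B A' B' : Set (V(G) × V(G))} {φ : Fourientation G}
  {u v x y : V(G)}

theorem reachVia_twoWayArcs_comm :
    D.ReachVia ∅ (twoWayArcs φ) u v ↔ D.ReachVia ∅ (twoWayArcs φ) v u :=
  ⟨ReachVia.symm fun _ => id, ReachVia.symm fun _ => id⟩

theorem hasTwoWayCycle_update_iff [DecidableEq E(G)] {e : E(G)} (hφ : φ e = .zeroWay)
    (h : ¬ D.HasTwoWayCycle φ) (c : Config) :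
    D.HasTwoWayCycle (Function.update φ e c) ↔
      c = .twoWay ∧ D.ReachVia ∅ (twoWayArcs φ) (D.tail e) (D.head e) := by
  constructor
  · rintro ⟨k, s, hs, hc⟩
    obtain ⟨i, rfl⟩ : ∃ i, (s i).1 = e := by
      by_contra! hne
      exact h ⟨k, s, hs, fun i => by simpa [hne] using hc i⟩
    have hreach : D.ReachVia ∅ (twoWayArcs φ) (D.tgt (s i)) (D.src (s i)) := by
      refine (hs.reachVia i).mono subset_rfl ?_
      rintro _ ⟨⟨j, rfl⟩, hj⟩
      simpa [hj] using hc j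
    refine ⟨by simpa using hc i, ?_⟩
    obtain h | h := Arc.eq_or_eq_rev (a := s i) (b := ((s i).1, true)) rfl
    · rw [h] at hreach
      exact reachVia_twoWayArcs_comm.1 hreach
    · rw [h, src_rev, tgt_rev] at hreach
      exact hreach
  · rintro ⟨rfl, hreach⟩
    have hne : ∀ b ∈ twoWayArcs φ, b.1 ≠ e := by
      rintro b hb rfl
      simp [hφ] at hb
    obtain ⟨k, s, hs, -, hT⟩ := exists_isCycle_of_reachVia (a := (e, false)) hne hreach
    refine ⟨k, s, hs, fun i => ?_⟩
    obtain h | h := hT i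
    · simp [h]
    · simpa [hne _ h] using h

section CycleMinimal

variable [LinearOrder E(G)]

theorem twoWayArcs_subset_upperArcs (m : E(G)) : twoWayArcs φ ⊆ upperArcs φ m :=
  fun _ => .inl

theorem upperArcs_subset_arcs (m : E(G)) : upperArcs φ m ⊆ arcs φ := by
  rintro a (ha | ha)
  · simp [ha]
  · exact ha.1

theorem upperArcs_anti {m m' : E(G)} (h : m ≤ m') : upperArcs φ m' ⊆ upperArcs φ m :=
  fun _ => Or.imp_right <| And.imp_right h.trans_lt

theorem reach_of_reachVia_upperArcs {m : E(G)} (h : D.ReachVia ∅ (upperArcs φ m) u v) :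
    D.Reach A B φ u v :=
  reach_iff_reachVia.2 (h.mono (Set.empty_subset _) (upperArcs_subset_arcs m))

variable (D) in
/-- No cycle of `φ` is made of 2-way edges, and in each directed cycle of `φ` the least 1-way edge
has its conventional direction. Every cycle equivalence class without 2-way cycles contains exactly
one such fourientation. -/
def CycleMinimal (φ : Fourientation G) : Prop :=
  ¬ D.HasTwoWayCycle φ ∧
    ∀ m, φ m = .backward → ¬ D.ReachVia ∅ (upperArcs φ m) (D.tail m) (D.head m)

variable (D) in
/-- Permitting the arc `a`, on an edge larger than all others and 0-way in `φ`, creates a directed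
cycle in which the least 1-way edge has its unconventional direction, or makes the edge of `a` such
an edge or a part of a 2-way cycle (the latter is charged to the unconventional arc). -/
def Blocked (φ : Fourientation G) (a : Arc G) : Prop :=
  (∃ m, φ m = .backward ∧ D.ReachVia ∅ (upperArcs φ m) (D.tail m) (D.src a) ∧
    D.ReachVia ∅ (upperArcs φ m) (D.tgt a) (D.head m)) ∨
  a.2 = false ∧ D.ReachVia ∅ (twoWayArcs φ) (D.tgt a) (D.src a)

theorem Blocked.reach {a : Arc G} (h : D.Blocked φ a) : D.Reach A B φ (D.tgt a) (D.src a) := by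
  obtain ⟨m, hm, h₁, h₂⟩ | ⟨-, h⟩ := h
  · have hstep : D.Adj A B φ (D.head m) (D.tail m) := .inl ⟨(m, false), by simp [hm, Config.Allows]⟩
    exact ((reach_of_reachVia_upperArcs h₂).tail hstep).trans (reach_of_reachVia_upperArcs h₁)
  · exact reach_of_reachVia_upperArcs (h.mono subset_rfl (twoWayArcs_subset_upperArcs a.1))

theorem CycleMinimal.not_reachVia_of_le (hφ : D.CycleMinimal φ) {m m' : E(G)} (hle : m ≤ m')
    (hm : φ m = .backward) (hm' : φ m' = .backward)
    (h₁ : D.ReachVia ∅ (upperArcs φ m) (D.tail m) x)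
    (h₂ : D.ReachVia ∅ (upperArcs φ m) y (D.head m))
    (h₁' : D.ReachVia ∅ (upperArcs φ m') (D.tail m') y) :
    ¬ D.ReachVia ∅ (upperArcs φ m') x (D.head m') := by
  intro h₂'
  have hx := h₁.trans (h₂'.mono subset_rfl (upperArcs_anti hle))
  have hy := (h₁'.mono subset_rfl (upperArcs_anti hle)).trans h₂
  obtain rfl | hlt := hle.eq_or_lt
  · exact hφ.2 m hm hx
  · have hstep : D.StepVia ∅ (upperArcs φ m) (D.head m') (D.tail m') :=
      stepVia_of_mem (a := (m', false)) (.inr ⟨by simp [hm', Config.Allows], hlt⟩)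
    exact hφ.2 m hm ((hx.tail hstep).trans hy)

theorem CycleMinimal.not_reachVia_of_twoWay (hφ : D.CycleMinimal φ) {m : E(G)}
    (hm : φ m = .backward) (hxy : D.ReachVia ∅ (twoWayArcs φ) x y)
    (h₁ : D.ReachVia ∅ (upperArcs φ m) (D.tail m) x) :
    ¬ D.ReachVia ∅ (upperArcs φ m) y (D.head m) := fun h₂ =>
  hφ.2 m hm ((h₁.trans (hxy.mono subset_rfl (twoWayArcs_subset_upperArcs m))).trans h₂)

theorem CycleMinimal.not_blocked_rev (hφ : D.CycleMinimal φ) {a : Arc G} (h : D.Blocked φ a) :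
    ¬ D.Blocked φ a.rev := by
  intro h'
  simp only [Blocked, src_rev, tgt_rev, Arc.rev_snd] at h h'
  obtain ⟨m, hm, h₁, h₂⟩ | ⟨ha, h⟩ := h <;> obtain ⟨m', hm', h₁', h₂'⟩ | ⟨ha', h'⟩ := h'
  · obtain hle | hle := le_total m m'
    · exact hφ.not_reachVia_of_le hle hm hm' h₁ h₂ h₁' h₂'
    · exact hφ.not_reachVia_of_le hle hm' hm h₁' h₂' h₁ h₂
  · exact hφ.not_reachVia_of_twoWay hm h' h₁ h₂
  · exact hφ.not_reachVia_of_twoWay hm' h h₁' h₂'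
  · simp [ha] at ha'

variable {e : E(G)}

theorem reachVia_upperArcs_update_iff (hφ : φ e = .zeroWay) {m : E(G)} (hm : m < e) (c : Config) :
    D.ReachVia ∅ (upperArcs (Function.update φ e c) m) u v ↔
      D.ReachVia ∅ (upperArcs φ m) u v ∨ ∃ d, c.Allows d ∧
        D.ReachVia ∅ (upperArcs φ m) u (D.src (e, d)) ∧
        D.ReachVia ∅ (upperArcs φ m) (D.tgt (e, d)) v := by
  have hsub : upperArcs φ m ⊆ upperArcs (Function.update φ e c) m := by
    intro a ha
    have hae : a.1 ≠ e := by
      rintro rfl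
      simp [upperArcs, hφ] at ha
    simpa [upperArcs, hae] using ha
  rw [reachVia_iff_of_arcs hsub (e := e) fun a ha hae => by simpa [upperArcs, hae] using ha]
  have hmem (d : Bool) : (e, d) ∈ upperArcs (Function.update φ e c) m ↔ c.Allows d := by
    simp only [upperArcs, Set.mem_ofPred_eq, Function.update_self, hm, and_true,
      or_iff_right_iff_imp]
    rintro rfl
    trivial
  simp only [hmem]

theorem upperArcs_update_backward_self (he : IsTop e) (hφ : φ e = .zeroWay) :
    upperArcs (Function.update φ e .backward) e = twoWayArcs φ := by
  ext a
  by_cases ha : a.1 = e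
  · simp [upperArcs, twoWayArcs, ha, hφ]
  · simp [upperArcs, twoWayArcs, ha, (he a.1).not_gt]

theorem CycleMinimal.of_update (he : IsTop e) (hφ : φ e = .zeroWay) {c : Config}
    (h : D.CycleMinimal (Function.update φ e c)) : D.CycleMinimal φ := by
  have hne {c' : Config} (hc' : c' ≠ .zeroWay) {m : E(G)} (hm : φ m = c') : m ≠ e := by
    rintro rfl
    exact hc' (hm.symm.trans hφ)
  refine ⟨fun h₂ => h.1 (h₂.mono fun m hm => ?_), fun m hm hreach => ?_⟩
  · simpa [hne (by simp) hm] using hm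
  · have hme := hne (by simp) hm
    exact h.2 m (by simpa [hme] using hm)
      ((reachVia_upperArcs_update_iff hφ ((he m).lt_of_ne hme) c).2 (.inl hreach))

theorem cycleMinimal_update_iff (he : IsTop e) (hφ : φ e = .zeroWay) (hmin : D.CycleMinimal φ)
    (c : Config) :
    D.CycleMinimal (Function.update φ e c) ↔ ∀ d, c.Allows d → ¬ D.Blocked φ (e, d) := by
  have hlt {m : E(G)} (hm : φ m = .backward) : m < e := by
    refine (he m).lt_of_ne ?_
    rintro rfl
    simp [hφ] at hm
  rw [CycleMinimal, hasTwoWayCycle_update_iff hφ hmin.1]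
  constructor
  · rintro ⟨h₂, hb⟩ d hd (⟨m, hm, h₁, h₁'⟩ | ⟨rfl, h₁⟩)
    · exact hb m (by simpa [(hlt hm).ne] using hm)
        ((reachVia_upperArcs_update_iff hφ (hlt hm) c).2 (.inr ⟨d, hd, h₁, h₁'⟩))
    · cases c with
      | zeroWay => exact hd
      | forward => cases hd
      | backward => exact hb e (by simp) (by rwa [upperArcs_update_backward_self he hφ])
      | twoWay => exact h₂ ⟨rfl, h₁⟩
  · refine fun h => ⟨fun ⟨hc, h₁⟩ => h false (by simp [hc]) (.inr ⟨rfl, h₁⟩), ?_⟩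
    intro m hm hreach
    by_cases hme : m = e
    · subst hme
      obtain rfl : c = .backward := by simpa using hm
      rw [upperArcs_update_backward_self he hφ] at hreach
      exact h false rfl (.inr ⟨rfl, hreach⟩)
    · rw [Function.update_of_ne hme] at hm
      obtain h₀ | ⟨d, hd, h₁, h₁'⟩ := (reachVia_upperArcs_update_iff hφ (hlt hm) c).1 hreach
      · exact hmin.2 m hm h₀
      · exact h d hd (.inl ⟨m, hm, h₁, h₁'⟩)

theorem toggleInvariant_cycleMinimal (he : IsTop e) (hφ : φ e = .zeroWay) :
    (∃ d, ToggleInvariant D.CycleMinimal φ e d ∧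
      ∀ A B, D.Reach A B φ (D.src (e, d)) (D.tgt (e, d))) ∨
    ∀ d, ToggleInvariant D.CycleMinimal φ e d := by
  by_cases hmin : D.CycleMinimal φ
  swap
  · exact .inr (toggleInvariant_of_forall_iff (p := False) fun c =>
      iff_false_intro fun h => hmin (h.of_update he hφ))
  by_cases hblocked : ∃ d, D.Blocked φ (e, !d)
  · obtain ⟨d, hd⟩ := hblocked
    have hfree : ¬ D.Blocked φ (e, d) := by
      simpa [Arc.rev] using hmin.not_blocked_rev hd
    refine .inl ⟨d, fun c => ?_, fun A B => ?_⟩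
    · simp only [cycleMinimal_update_iff he hφ hmin, Bool.forall_bool' d, hfree, not_false_eq_true,
        implies_true, true_and, Config.allows_toggle_not]
    · rw [← D.tgt_rev (e, d), ← D.src_rev (e, d)]
      exact hd.reach
  · refine .inr (toggleInvariant_of_forall_iff (p := True) fun c => ?_)
    simp only [not_exists, Bool.forall_bool, Bool.not_false, Bool.not_true] at hblocked
    simp [cycleMinimal_update_iff he hφ hmin, hblocked]

theorem exists_toggleInvariant_valid_cycleMinimal (hAB : A ∪ B ⊆ A' ∪ B') (he : IsTop e)
    (hφ : φ e = .zeroWay) :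
    ∃ d, (ToggleInvariant (D.Valid A B) φ e d ∧ ToggleInvariant (D.Valid A' B') φ e d) ∧
      ToggleInvariant D.CycleMinimal φ e d := by
  obtain ⟨d, hd, hreach⟩ | hany := toggleInvariant_cycleMinimal (D := D) he hφ
  · exact ⟨d, ⟨toggleInvariant_valid_of_reach hφ (hreach A B),
      toggleInvariant_valid_of_reach hφ (hreach A' B')⟩, hd⟩
  · obtain ⟨d, hd⟩ := exists_toggleInvariant_valid hAB hφ
    exact ⟨d, hd, hany d⟩

end CycleMinimal

end RefOrientation

/-! ### Comparing solid sets -/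

theorem solid_update_toggle [DecidableEq E(G)] (φ : Fourientation G) (e : E(G)) (d : Bool) :
    solid (Function.update φ e ((φ e).toggle d)) = symmDiff (solid φ) {e} := by
  ext m
  by_cases hm : m = e
  · subst hm
    simpa [solid, Set.mem_symmDiff] using Config.toggle_eq_zeroWay_or_eq_twoWay d (φ m)
  · simp [solid, Set.mem_symmDiff, hm]

theorem ncard_solid_symmDiff [DecidableEq E(G)] {P : Fourientation G → Prop} {e : E(G)}
    (hP : ∀ φ : Fourientation G, φ e = .zeroWay → ∃ d, ToggleInvariant P φ e d) (S : Set E(G)) :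
    {φ | solid φ = S ∧ P φ}.ncard = {φ | solid φ = symmDiff S {e} ∧ P φ}.ncard := by
  have hP' (φ : Fourientation G) : ∃ d, ToggleInvariant P (Function.update φ e .zeroWay) e d :=
    hP _ (Function.update_self ..)
  choose d hd using hP'
  -- The direction depends on the other edges only, so that toggling twice changes nothing.
  let T (φ : Fourientation G) : Fourientation G :=
    Function.update φ e ((φ e).toggle (d (Function.update φ e .zeroWay)))
  have hT : Function.Involutive T := fun φ => by simp [T]
  have hPT (φ : Fourientation G) : P (T φ) ↔ P φ := by
    simpa [T] using hd (Function.update φ e .zeroWay) (φ e)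
  have himage : T '' {φ | solid φ = S ∧ P φ} = {φ | solid φ = symmDiff S {e} ∧ P φ} := by
    rw [hT.image_eq_preimage_symm]
    ext φ
    have hsolid : solid (T φ) = S ↔ solid φ = symmDiff S {e} := by
      rw [solid_update_toggle, ← symmDiff_left_inj (b := {e}), symmDiff_symmDiff_cancel_right]
    simp only [Set.mem_preimage, Set.mem_ofPred_eq, hPT, hsolid]
  rw [← himage, Set.ncard_image_of_injective _ hT.injective]

theorem exists_linearOrder_isTop {E : Type*} (e : E) : ∃ _ : LinearOrder E, IsTop e := by
  classical
  let _ : LinearOrder E := linearOrderOfSTO WellOrderingRel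
  have hinj : Function.Injective fun m : E => toLex (m = e, m) :=
    fun _ _ h => congrArg (fun p => (ofLex p).2) h
  refine ⟨LinearOrder.lift' _ hinj, fun m => ?_⟩
  change toLex (m = e, m) ≤ toLex (e = e, e)
  rw [Prod.Lex.toLex_le_toLex]
  by_cases hm : m = e
  · simp [hm]
  · simp [hm, lt_iff_le_not_ge]

theorem eq_of_eq_symmDiff_singleton {E N : Type*} [Finite E] {f : Set E → N}
    (h : ∀ S e, f S = f (symmDiff S {e})) (S S' : Set E) : f S = f S' := by
  suffices hempty : ∀ S : Set E, f S = f ∅ from (hempty S).trans (hempty S').symm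
  intro S
  induction S, S.toFinite using Set.Finite.induction_on with
  | empty => rfl
  | @insert e S he _ ih =>
    have hS : symmDiff S {e} = insert e S := by
      rw [(Set.disjoint_singleton_right.2 he).symmDiff_eq_sup]
      exact Set.union_singleton
    rw [← hS, ← h, ih]

/-! ### Reversals -/

namespace Config

@[simp] theorem reverse_reverse (c : Config) : c.reverse.reverse = c := by
  cases c <;> rfl

@[simp] theorem reverse_eq_twoWay {c : Config} : c.reverse = .twoWay ↔ c = .twoWay := by
  cases c <;> simp [reverse]

@[simp] theorem reverse_eq_zeroWay {c : Config} : c.reverse = .zeroWay ↔ c = .zeroWay := by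
  cases c <;> simp [reverse]

@[simp] theorem allows_reverse {c : Config} {d : Bool} : c.reverse.Allows d ↔ c.Allows !d := by
  cases c <;> cases d <;> simp [reverse, Allows]

end Config

section reverseOn

variable {F : Set E(G)} {φ : Fourientation G} {e : E(G)}

theorem reverseOn_of_mem (h : e ∈ F) : reverseOn F φ e = (φ e).reverse := if_pos h

theorem reverseOn_of_notMem (h : e ∉ F) : reverseOn F φ e = φ e := if_neg h

@[simp] theorem reverseOn_reverseOn (F : Set E(G)) (φ : Fourientation G) :
    reverseOn F (reverseOn F φ) = φ := by
  ext e
  by_cases h : e ∈ F <;> simp [reverseOn, h]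

theorem reverseOn_comm (F F' : Set E(G)) (φ : Fourientation G) :
    reverseOn F (reverseOn F' φ) = reverseOn F' (reverseOn F φ) := by
  ext e
  by_cases h : e ∈ F <;> by_cases h' : e ∈ F' <;> simp [reverseOn, h, h']

end reverseOn

/-- `ψ` is obtained from `φ` by reversing some of its edges. -/
def SameUpToReversal (φ ψ : Fourientation G) : Prop :=
  ∀ e, ψ e = φ e ∨ ψ e = (φ e).reverse

namespace SameUpToReversal

variable {φ ψ χ : Fourientation G}

theorem refl (φ : Fourientation G) : SameUpToReversal φ φ := fun _ => .inl rfl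

theorem symm (h : SameUpToReversal φ ψ) : SameUpToReversal ψ φ := fun e =>
  (h e).imp Eq.symm fun h => by rw [h, Config.reverse_reverse]

theorem trans (h : SameUpToReversal φ ψ) (h' : SameUpToReversal ψ χ) :
    SameUpToReversal φ χ := by
  intro e
  obtain h | h := h e <;> obtain h' | h' := h' e <;> simp [h, h']

theorem eq_twoWay_iff (h : SameUpToReversal φ ψ) (e : E(G)) :
    ψ e = .twoWay ↔ φ e = .twoWay := by
  obtain h | h := h e <;> simp [h]

theorem eq_zeroWay_iff (h : SameUpToReversal φ ψ) (e : E(G)) :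
    ψ e = .zeroWay ↔ φ e = .zeroWay := by
  obtain h | h := h e <;> simp [h]

theorem solid_eq (h : SameUpToReversal φ ψ) : solid ψ = solid φ := by
  simp only [solid, h.eq_twoWay_iff, h.eq_zeroWay_iff]

variable {D : RefOrientation G} {A B : Set (V(G) × V(G))}

theorem hasTwoWayCycle_iff (h : SameUpToReversal φ ψ) :
    D.HasTwoWayCycle ψ ↔ D.HasTwoWayCycle φ := by
  simp only [RefOrientation.HasTwoWayCycle, h.eq_twoWay_iff]

theorem hasZeroWayCocycle_iff (h : SameUpToReversal φ ψ) :
    D.HasZeroWayCocycle A B ψ ↔ D.HasZeroWayCocycle A B φ := by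
  simp only [RefOrientation.HasZeroWayCocycle, h.eq_zeroWay_iff]

end SameUpToReversal

theorem sameUpToReversal_reverseOn (F : Set E(G)) (φ : Fourientation G) :
    SameUpToReversal φ (reverseOn F φ) := fun e => by
  by_cases h : e ∈ F
  · exact .inr (reverseOn_of_mem h)
  · exact .inl (reverseOn_of_notMem h)

namespace RefOrientation

variable {D : RefOrientation G} {A B : Set (V(G) × V(G))} {φ ψ χ : Fourientation G}
  {u v : V(G)}

section CycleStep

theorem IsCycle.reach {k : ℕ} {c : Fin (k + 1) → Arc G} (hc : D.IsCycle c)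
    (hφ : ∀ i, (φ (c i).1).Allows (c i).2) (i j : Fin (k + 1)) :
    D.Reach A B φ (D.src (c i)) (D.src (c j)) :=
  reflTransGen_of_cyclic (r := D.Adj A B φ) (v := fun i => D.src (c i))
    (fun i => .inl ⟨c i, hφ i, rfl, hc.closed i⟩) i j

theorem CycleStep.sameUpToReversal (h : D.CycleStep φ ψ) : SameUpToReversal φ ψ := by
  obtain ⟨_, _, _, _, rfl⟩ := h
  exact sameUpToReversal_reverseOn _ _

theorem CycleStep.symm (h : D.CycleStep φ ψ) : D.CycleStep ψ φ := by
  obtain ⟨k, c, hc, hφ, rfl⟩ := h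
  have hrange : (Set.range fun i => (c (-i)).rev.1) = Set.range fun i => (c i).1 :=
    (Equiv.neg (Fin (k + 1))).surjective.range_comp fun i => (c i).1
  refine ⟨k, fun i => (c (-i)).rev, ⟨fun i => ?_, fun i j hij => ?_, fun i j hij => ?_⟩,
    fun i => ?_, ?_⟩
  · rw [tgt_rev, src_rev, hc.closed]
    congr 2
    abel
  · simp only [src_rev, hc.closed] at hij
    simpa using hc.vertices hij
  · simpa using hc.edges hij
  · rw [Arc.rev_fst, reverseOn_of_mem (Set.mem_range_self (f := fun i => (c i).1) (-i)),
      Config.allows_reverse, Arc.rev_snd, Bool.not_not]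
    exact hφ _
  · rw [hrange, reverseOn_reverseOn]

theorem CycleStep.reach (h : D.CycleStep φ ψ) (huv : D.Reach A B ψ u v) :
    D.Reach A B φ u v := by
  obtain ⟨k, c, hc, hφ, rfl⟩ := h
  induction huv with
  | refl => exact .refl
  | tail _ hstep ih =>
    obtain ⟨a, ha, rfl, rfl⟩ | hpair := hstep
    · by_cases hmem : a.1 ∈ Set.range fun i => (c i).1
      · obtain ⟨i, hi⟩ := hmem
        obtain rfl | rfl := Arc.eq_or_eq_rev hi.symm
        · exact ih.tail (.inl ⟨c i, hφ i, rfl, rfl⟩)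
        · rw [src_rev, hc.closed] at ih
          rw [tgt_rev]
          exact ih.trans (hc.reach hφ _ _)
      · rw [reverseOn_of_notMem hmem] at ha
        exact ih.tail (.inl ⟨a, ha, rfl, rfl⟩)
    · exact ih.tail (.inr hpair)

theorem CycleStep.reach_iff (h : D.CycleStep φ ψ) :
    D.Reach A B ψ u v ↔ D.Reach A B φ u v :=
  ⟨h.reach, h.symm.reach⟩

theorem CycleStep.valid_iff (h : D.CycleStep φ ψ) : D.Valid A B ψ ↔ D.Valid A B φ := by
  simp only [Valid, h.reach_iff]

end CycleStep

section CocycleStep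

variable {U : Set V(G)}

theorem cut_compl (U : Set V(G)) : D.cut Uᶜ = D.cut U := by
  ext e
  simp [cut, not_iff_not]

theorem mem_cut_iff (a : Arc G) : a.1 ∈ D.cut U ↔ ¬ (D.src a ∈ U ↔ D.tgt a ∈ U) := by
  obtain ⟨e, _ | _⟩ := a <;> simp [cut, iff_comm]

theorem Reach.mem_of_closed (hU : ∀ u v, D.Adj A B φ u v → u ∈ U → v ∈ U)
    (h : D.Reach A B φ u v) (hu : u ∈ U) : v ∈ U := by
  induction h with
  | refl => exact hu
  | tail _ hstep ih => exact hU _ _ hstep ih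

theorem notMem_of_adj (hAB : ∀ u v, (u, v) ∈ A ∪ B → (u ∈ U ↔ v ∈ U))
    (hφ : ∀ a : Arc G, (φ a.1).Allows a.2 → D.src a ∉ U → D.tgt a ∉ U)
    (h : D.Adj A B φ u v) (hu : u ∉ U) : v ∉ U := by
  obtain ⟨a, ha, rfl, rfl⟩ | huv := h
  · exact hφ a ha hu
  · rwa [← hAB u v huv]

theorem CocycleStep.sameUpToReversal (h : D.CocycleStep A B φ ψ) : SameUpToReversal φ ψ := by
  obtain ⟨_, _, _, rfl⟩ := h
  exact sameUpToReversal_reverseOn _ _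

theorem CocycleStep.symm (h : D.CocycleStep A B φ ψ) : D.CocycleStep A B ψ φ := by
  obtain ⟨U, ⟨hne, hAB⟩, hφ, rfl⟩ := h
  refine ⟨Uᶜ, ⟨by rwa [cut_compl], fun u v huv => not_congr (hAB u v huv)⟩, ?_,
    by rw [cut_compl, reverseOn_reverseOn]⟩
  intro a ha hsrc htgt
  rw [Set.notMem_compl_iff] at hsrc
  rw [reverseOn_of_mem ((mem_cut_iff a).2 fun h => htgt (h.1 hsrc)), Config.allows_reverse] at ha
  exact hφ a.rev ha (by rwa [src_rev]) (by rwa [tgt_rev])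

/-- No path leads back into `U` once it has left it, so a path with both ends on the same side
avoids the cut. -/
theorem CocycleStep.reach_of_mem (h : D.CocycleStep A B φ ψ) (huv : (u, v) ∈ A ∪ B)
    (hr : D.Reach A B φ v u) : D.Reach A B ψ v u := by
  obtain ⟨U, ⟨-, hAB⟩, hφ, rfl⟩ := h
  have hout {b c} (hbc : D.Reach A B φ b c) : b ∉ U → c ∉ U :=
    hbc.mem_of_closed (U := Uᶜ) fun _ _ => notMem_of_adj hAB hφ
  have hsame : v ∈ U ↔ u ∈ U := (hAB u v huv).symm
  clear huv
  induction hr using ReflTransGen.head_induction_on with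
  | refl => exact .refl
  | @head b c hbc hcu ih =>
    have hiff : b ∈ U ↔ c ∈ U := by
      have := hout hcu
      have := hout (.single hbc)
      tauto
    refine .head ?_ (ih (hiff.symm.trans hsame))
    obtain ⟨a, ha, rfl, rfl⟩ | hpair := hbc
    · refine .inl ⟨a, ?_, rfl, rfl⟩
      rwa [reverseOn_of_notMem]
      simpa only [mem_cut_iff, not_not] using hiff
    · exact .inr hpair

theorem CocycleStep.valid (h : D.CocycleStep A B φ ψ) (hφ : D.Valid A B φ) : D.Valid A B ψ :=
  ⟨fun u v huv hr => hφ.1 u v huv (h.symm.reach_of_mem (.inl huv) hr),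
    fun u v huv => h.reach_of_mem (.inr huv) (hφ.2 u v huv)⟩

end CocycleStep

/-- A directed cycle and a directed cut have no edge in common, so their reversals commute. -/
theorem CycleStep.exists_cocycleStep (h : D.CycleStep φ ψ) (h' : D.CocycleStep A B φ χ) :
    ∃ ω, D.CocycleStep A B ψ ω ∧ D.CycleStep χ ω := by
  obtain ⟨k, c, hc, hcφ, rfl⟩ := h
  obtain ⟨U, hU, hUφ, rfl⟩ := h'
  have hcut (i : Fin (k + 1)) : (c i).1 ∉ D.cut U := by
    have hout {i j} : D.src (c i) ∉ U → D.src (c j) ∉ U :=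
      (hc.reach (A := A) (B := B) hcφ i j).mem_of_closed (U := Uᶜ)
        fun _ _ => notMem_of_adj hU.2 hUφ
    rw [mem_cut_iff, not_not, hc.closed]
    exact not_iff_not.1 ⟨hout, hout⟩
  refine ⟨_, ⟨U, hU, fun a ha => ?_, rfl⟩, k, c, hc, fun i => ?_, reverseOn_comm _ _ _⟩
  · by_cases hmem : a.1 ∈ Set.range fun i => (c i).1
    · obtain ⟨i, hi⟩ := hmem
      have := hcut i
      rw [show (c i).1 = a.1 from hi, mem_cut_iff, not_not] at this
      exact mt this.2
    · rw [reverseOn_of_notMem hmem] at ha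
      exact hUφ a ha
  · rw [reverseOn_of_notMem (hcut i)]
    exact hcφ i

end RefOrientation

/-! ### Representatives of cycle equivalence classes -/

namespace Config

instance : Finite Config :=
  Finite.of_surjective (α := Bool × Bool)
    (fun
      | (false, false) => zeroWay
      | (true, false) => forward
      | (false, true) => backward
      | (true, true) => twoWay)
    fun c => by cases c <;> simp

/-- The direction of a 1-way edge as a sign, the conventional one being positive; `0` for a solid
edge. -/
def sign : Config → ℤ
  | zeroWay => 0
  | forward => 1
  | backward => -1
  | twoWay => 0

@[simp] theorem sign_reverse (c : Config) : c.reverse.sign = -c.sign := by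
  cases c <;> rfl

theorem exists_allows {c : Config} (h : c ≠ zeroWay) : ∃ d, c.Allows d := by
  cases c <;> simp_all [Allows]

end Config

namespace RefOrientation

variable {D : RefOrientation G} {φ ψ : Fourientation G} {f : V(G) → ℤ}

variable (D) in
/-- The decrease of `f` along the edge `e` in its conventional direction. -/
def coboundary (f : V(G) → ℤ) (e : E(G)) : ℤ := f (D.tail e) - f (D.head e)

theorem sign_mul_coboundary {a : Arc G} (ha : (φ a.1).Allows a.2)
    (hf : φ a.1 = .twoWay → f (D.tail a.1) = f (D.head a.1)) :
    (φ a.1).sign * D.coboundary f a.1 = f (D.src a) - f (D.tgt a) := by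
  obtain ⟨e, _ | _⟩ := a <;> cases h : φ e <;>
    simp_all [Config.Allows, Config.sign, coboundary]

section Flux

variable [Fintype E(G)]

variable (D) in
/-- The total decrease of `f` along the 1-way edges of `φ`. It is the only invariant of a cycle
equivalence class that is needed to tell cycle-minimal fourientations apart. -/
def flux (φ : Fourientation G) (f : V(G) → ℤ) : ℤ := ∑ e, (φ e).sign * D.coboundary f e

theorem CycleStep.flux_eq (h : D.CycleStep φ ψ)
    (hf : ∀ e, φ e = .twoWay → f (D.tail e) = f (D.head e)) : D.flux φ f = D.flux ψ f := by
  obtain ⟨k, c, hc, hφ, rfl⟩ := h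
  have hshift : ∑ i, f (D.src (c (i + 1))) = ∑ i, f (D.src (c i)) :=
    Equiv.sum_comp (Equiv.addRight (1 : Fin (k + 1))) fun i => f (D.src (c i))
  have htelescope : ∑ i, 2 * (f (D.src (c i)) - f (D.tgt (c i))) = 0 := by
    rw [← Finset.mul_sum, Finset.sum_sub_distrib]
    simp only [hc.closed, hshift, sub_self, mul_zero]
  rw [← sub_eq_zero, flux, flux, ← Finset.sum_sub_distrib, ← htelescope, eq_comm]
  refine Fintype.sum_of_injective (fun i => (c i).1) hc.edges _ _ (fun e he => ?_) fun i => ?_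
  · rw [reverseOn_of_notMem he, sub_self]
  · rw [reverseOn_of_mem (Set.mem_range_self (f := fun i => (c i).1) i), Config.sign_reverse,
      ← sign_mul_coboundary (hφ i) (hf _)]
    ring

theorem CycleEquiv.flux_eq (h : D.CycleEquiv φ ψ)
    (hf : ∀ e, φ e = .twoWay → f (D.tail e) = f (D.head e)) : D.flux φ f = D.flux ψ f := by
  induction h using ReflTransGen.head_induction_on with
  | refl => rfl
  | head hstep _ ih =>
    rw [hstep.flux_eq hf]
    exact ih fun e he => hf e ((hstep.sameUpToReversal.eq_twoWay_iff e).1 he)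

end Flux

theorem CycleEquiv.sameUpToReversal (h : D.CycleEquiv φ ψ) : SameUpToReversal φ ψ := by
  induction h with
  | refl => exact .refl φ
  | tail _ hstep ih => exact ih.trans hstep.sameUpToReversal

theorem CycleEquiv.eq_of_forall_le [Finite E(G)] (h : D.CycleEquiv φ ψ)
    (hf : ∀ e, φ e = .twoWay → f (D.tail e) = f (D.head e))
    (hle : ∀ a ∈ arcs φ, φ a.1 ≠ ψ a.1 → f (D.src a) ≤ f (D.tgt a)) {a : Arc G} (ha : a ∈ arcs φ)
    (hne : φ a.1 ≠ ψ a.1) : f (D.src a) = f (D.tgt a) := by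
  cases nonempty_fintype E(G)
  have hsign {a : Arc G} (hne : φ a.1 ≠ ψ a.1) :
      (ψ a.1).sign * D.coboundary f a.1 = -((φ a.1).sign * D.coboundary f a.1) := by
    rw [(h.sameUpToReversal a.1).resolve_left hne.symm, Config.sign_reverse, neg_mul]
  have hterm : ∀ e ∈ Finset.univ,
      (φ e).sign * D.coboundary f e ≤ (ψ e).sign * D.coboundary f e := by
    intro e _
    by_cases hne : φ e = ψ e
    · rw [hne]
    have hzero : φ e ≠ .zeroWay := fun he =>
      hne (he.trans ((h.sameUpToReversal.eq_zeroWay_iff e).2 he).symm)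
    obtain ⟨d, hd⟩ := Config.exists_allows hzero
    have hdecr := hle (e, d) hd hne
    rw [hsign (a := (e, d)) hne, sign_mul_coboundary (a := (e, d)) hd (hf _)]
    linarith
  have heq := (Finset.sum_eq_sum_iff_of_le hterm).1 (h.flux_eq hf) a.1 (Finset.mem_univ _)
  rw [hsign hne, sign_mul_coboundary ha (hf _)] at heq
  linarith

theorem CycleEquiv.symm (h : D.CycleEquiv φ ψ) : D.CycleEquiv ψ φ :=
  reflTransGen_swap.1 (ReflTransGen.mono (fun _ _ => CycleStep.symm) _ _ h)

section CycleMinimal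

variable [LinearOrder E(G)] {m : E(G)}

/-- The function equal to `1` on the set of vertices reached from `tail m` through `upperArcs φ m`
and to `0` elsewhere decreases along no edge on which `φ` and `ψ` differ, and it would increase
along `m` if `m` were traversed backward. -/
theorem CycleMinimal.ne_backward [Finite E(G)] (hφ : D.CycleMinimal φ) (h : D.CycleEquiv φ ψ)
    (hm : φ m ≠ ψ m) (hmin : ∀ e, φ e ≠ ψ e → m ≤ e) : φ m ≠ .backward := by
  classical
  intro hmb
  let U : Set V(G) := {v | D.ReachVia ∅ (upperArcs φ m) (D.tail m) v}
  let f : V(G) → ℤ := fun v => if v ∈ U then 1 else 0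
  have htail : D.tail m ∈ U := ReflTransGen.refl
  have hhead : D.head m ∉ U := hφ.2 m hmb
  have hclosed : ∀ a ∈ upperArcs φ m, D.src a ∈ U → D.tgt a ∈ U := fun a ha hs =>
    ReflTransGen.tail hs (stepVia_of_mem ha)
  have hf : ∀ e, φ e = .twoWay → f (D.tail e) = f (D.head e) := fun e he => by
    have hiff : D.tail e ∈ U ↔ D.head e ∈ U :=
      ⟨hclosed (e, true) (.inl he), hclosed (e, false) (.inl he)⟩
    simp only [f, hiff]
  have hle : ∀ a ∈ arcs φ, φ a.1 ≠ ψ a.1 → f (D.src a) ≤ f (D.tgt a) := by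
    rintro ⟨e, d⟩ ha hne
    have htgt : D.src (e, d) ∈ U → D.tgt (e, d) ∈ U := by
      obtain rfl | hlt := (hmin _ hne).eq_or_lt
      · obtain rfl : d = false := by simpa [hmb, Config.Allows] using ha
        exact fun _ => htail
      · exact hclosed _ (.inr ⟨ha, hlt⟩)
    by_cases hsrc : D.src (e, d) ∈ U
    · simp [f, hsrc, htgt hsrc]
    · simp only [f, hsrc, if_false]
      positivity
  have heq := h.eq_of_forall_le hf hle (a := (m, false)) (by simp [hmb, Config.Allows]) hm
  simp [f, htail, hhead] at heq

theorem CycleMinimal.eq_of_cycleEquiv [Finite E(G)] (hφ : D.CycleMinimal φ)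
    (hψ : D.CycleMinimal ψ) (h : D.CycleEquiv φ ψ) : φ = ψ := by
  by_contra hne
  obtain ⟨m, hm, hmin⟩ := Set.exists_min_image {e | φ e ≠ ψ e} id (Set.toFinite _)
    (Function.ne_iff.1 hne)
  have hφm := hφ.ne_backward h hm hmin
  have hψm := hψ.ne_backward h.symm (Ne.symm hm) fun e he => hmin e he.symm
  have hrev := (h.sameUpToReversal m).resolve_left (Ne.symm hm)
  cases hc : φ m <;> simp_all [Config.reverse]

/-- A fourientation of the class with the lexicographically largest sequence of signs is
cycle-minimal. -/
theorem exists_cycleEquiv_cycleMinimal [Finite E(G)] (hφ : ¬ D.HasTwoWayCycle φ) :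
    ∃ ψ, D.CycleEquiv φ ψ ∧ D.CycleMinimal ψ := by
  obtain ⟨ψ, hψ, hmax⟩ := Set.exists_max_image {ψ | D.CycleEquiv φ ψ}
    (fun ψ => toLex fun e => (ψ e).sign) (Set.toFinite _) ⟨φ, ReflTransGen.refl⟩
  refine ⟨ψ, hψ, hψ.sameUpToReversal.hasTwoWayCycle_iff.not.2 hφ, fun m hm h => ?_⟩
  have hne : ∀ b ∈ upperArcs ψ m, b.1 ≠ m := by
    rintro b (hb | hb) rfl
    · simp [hm] at hb
    · exact hb.2.false
  obtain ⟨k, c, hc, ⟨i, hi⟩, hT⟩ := exists_isCycle_of_reachVia (a := (m, false)) hne h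
  have hallow : ∀ i, (ψ (c i).1).Allows (c i).2 := fun i => by
    obtain h | h := hT i
    · rw [h, hm]
      rfl
    · exact upperArcs_subset_arcs m h
  let F := Set.range fun i => (c i).1
  refine (hmax (reverseOn F ψ) (ReflTransGen.tail hψ ⟨k, c, hc, hallow, rfl⟩)).not_gt
    ⟨m, fun e he => ?_, ?_⟩
  · by_cases hmem : e ∈ F
    · obtain ⟨j, rfl⟩ := hmem
      obtain h | h | h := hT j
      · simp [h] at he
      · simp only [Pi.toLex_apply, F,
          reverseOn_of_mem (Set.mem_range_self (f := fun i => (c i).1) j), h, Config.reverse]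
      · exact absurd h.2 he.not_gt
    · simp only [Pi.toLex_apply, reverseOn_of_notMem hmem]
  · have hmem : m ∈ F := ⟨i, by simp [hi]⟩
    simp [reverseOn_of_mem hmem, hm, Config.reverse, Config.sign]

end CycleMinimal

end RefOrientation

/-! ### Representatives of cocycle equivalence classes -/

namespace RefOrientation

variable {D : RefOrientation G} {A B : Set (V(G) × V(G))} {φ ψ χ : Fourientation G}
  {u v : V(G)}

section Root

variable (D A B)

/-- Two vertices are equivalent if they are in the same connected component of the graph with the
pairs in `A` and `B` added as edges. -/
def componentSetoid : Setoid V(G) := Relation.EqvGen.setoid (D.Adj A B fun _ => .twoWay)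

/-- A vertex chosen in the connected component of `v`. -/
noncomputable def root (v : V(G)) : V(G) := (Quotient.mk (D.componentSetoid A B) v).out

/-- The pairs in `A` and `B` in both directions, and the pairs of a vertex and its root. -/
def rootArcs : Set (V(G) × V(G)) :=
  {x | x ∈ A ∪ B ∨ x.swap ∈ A ∪ B ∨ x.2 = D.root A B x.1}

/-- The vertices that can be reached from their root, when the pairs in `A` and `B` may be used in
both directions. -/
def rootedSet (φ : Fourientation G) : Set V(G) :=
  {v | D.Reach ∅ (D.rootArcs A B) φ (D.root A B v) v}

/-- Each vertex can be reached from its root, when the pairs in `A` and `B` may be used in both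
directions. Stated as a validity condition, to which the results on validity apply. Every cocycle
equivalence class without 0-way cocycles contains exactly one such fourientation. -/
def Rooted (φ : Fourientation G) : Prop := D.Valid ∅ (D.rootArcs A B) φ

variable {D A B}

theorem Adj.root_eq (h : D.Adj A B φ u v) : D.root A B u = D.root A B v := by
  refine congrArg Quotient.out (Quotient.sound (.rel _ _ ?_))
  exact h.imp_left fun ⟨a, _, h⟩ => ⟨a, trivial, h⟩

theorem root_src (a : Arc G) : D.root A B (D.src a) = D.root A B (D.tgt a) :=
  Adj.root_eq (φ := fun _ => .twoWay) (.inl ⟨a, trivial, rfl, rfl⟩)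

theorem root_eq_of_mem (h : (u, v) ∈ A ∪ B) : D.root A B u = D.root A B v :=
  Adj.root_eq (φ := fun _ => .twoWay) (.inr h)

@[simp] theorem root_root (v : V(G)) : D.root A B (D.root A B v) = D.root A B v :=
  congrArg Quotient.out (Quotient.out_eq (s := D.componentSetoid A B) _)

theorem root_mem_iff {U : Set V(G)} (hcut : D.cut U = ∅)
    (hAB : ∀ u v, (u, v) ∈ A ∪ B → (u ∈ U ↔ v ∈ U)) : D.root A B v ∈ U ↔ v ∈ U := by
  have hadj {u v} (h : D.Adj A B (fun _ => .twoWay) u v) : u ∈ U ↔ v ∈ U := by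
    obtain ⟨a, -, rfl, rfl⟩ | h := h
    · rw [← not_not (a := _ ↔ _), ← mem_cut_iff, hcut]
      exact Set.notMem_empty _
    · exact hAB _ _ h
  have hout : Relation.EqvGen (D.Adj A B fun _ => .twoWay) (D.root A B v) v :=
    Quotient.mk_out (s := D.componentSetoid A B) v
  generalize D.root A B v = r at hout
  induction hout with
  | rel _ _ h => exact hadj h
  | refl => exact Iff.rfl
  | symm _ _ _ ih => exact ih.symm
  | trans _ _ _ _ _ ih ih' => exact ih.trans ih'

theorem rooted_iff : D.Rooted A B φ ↔ D.rootedSet A B φ = Set.univ := by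
  rw [Set.eq_univ_iff_forall]
  refine ⟨fun h v => h.2 v _ (.inr (.inr rfl)), fun h => ⟨fun _ _ => False.elim, ?_⟩⟩
  rintro u v (huv | huv | huv)
  · exact .single (.inr (.inr (.inr (.inl huv))))
  · exact .single (.inr (.inr (.inl huv)))
  · obtain rfl : v = D.root A B u := huv
    exact h u

theorem root_mem_rootedSet (v : V(G)) : D.root A B v ∈ D.rootedSet A B φ := by
  rw [rootedSet, Set.mem_ofPred_eq, root_root]
  exact .refl

theorem mem_rootedSet_iff_of_mem (h : (u, v) ∈ A ∪ B) :
    u ∈ D.rootedSet A B φ ↔ v ∈ D.rootedSet A B φ := by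
  rw [rootedSet, Set.mem_ofPred_eq, Set.mem_ofPred_eq, root_eq_of_mem h]
  exact ⟨(·.tail (.inr (.inr (.inl h)))), (·.tail (.inr (.inr (.inr (.inl h)))))⟩

theorem tgt_mem_rootedSet {a : Arc G} (ha : a ∈ arcs φ) (h : D.src a ∈ D.rootedSet A B φ) :
    D.tgt a ∈ D.rootedSet A B φ := by
  rw [rootedSet, Set.mem_ofPred_eq, root_src] at *
  exact h.tail (.inl ⟨a, ha, rfl, rfl⟩)

theorem rootedSet_subset {W : Set V(G)} (hroot : ∀ v, D.root A B v ∈ W)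
    (hAB : ∀ u v, (u, v) ∈ A ∪ B → (u ∈ W ↔ v ∈ W))
    (harc : ∀ a ∈ arcs φ, D.src a ∈ W → D.tgt a ∈ W) : D.rootedSet A B φ ⊆ W := by
  refine fun v hv => Reach.mem_of_closed ?_ hv (hroot v)
  rintro u w (⟨a, ha, rfl, rfl⟩ | h | h | h | h) hu
  · exact harc a ha hu
  · exact h.elim
  · exact (hAB u w h).1 hu
  · exact (hAB w u h).2 hu
  · obtain rfl : w = D.root A B u := h
    exact hroot u

end Root

theorem Rooted.not_hasZeroWayCocycle (h : D.Rooted A B φ) : ¬ D.HasZeroWayCocycle A B φ := by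
  rintro ⟨U, ⟨⟨e, he⟩, hAB⟩, hU⟩
  have hW : D.rootedSet A B φ ⊆ {v | v ∈ U ↔ D.root A B v ∈ U} := by
    refine rootedSet_subset (fun v => by simp) (fun u v huv => ?_) fun a ha => ?_
    · simp only [Set.mem_ofPred_eq, hAB u v huv, root_eq_of_mem huv]
    · have hcut : a.1 ∉ D.cut U := fun hc => by simp [hU _ hc] at ha
      rw [mem_cut_iff, not_not] at hcut
      simp only [Set.mem_ofPred_eq, hcut, root_src, imp_self]
  rw [rooted_iff.1 h, Set.univ_subset_iff, Set.eq_univ_iff_forall] at hW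
  have hroot : D.root A B (D.tail e) = D.root A B (D.head e) := root_src (e, true)
  have htail : D.tail e ∈ U ↔ D.root A B (D.tail e) ∈ U := hW _
  exact he (htail.trans (hroot ▸ (hW (D.head e)).symm))

section Existence

theorem isABCut_rootedSet (h : ¬ D.Rooted A B φ) : D.IsABCut A B (D.rootedSet A B φ)ᶜ := by
  refine ⟨?_, fun u v huv => not_congr (mem_rootedSet_iff_of_mem huv)⟩
  rw [cut_compl, Set.nonempty_iff_ne_empty]
  refine fun hcut => h (rooted_iff.2 (Set.eq_univ_of_forall fun v => ?_))
  exact (root_mem_iff hcut fun _ _ => mem_rootedSet_iff_of_mem).1 (root_mem_rootedSet v)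

theorem rootedSet_subset_reverseOn :
    D.rootedSet A B φ ⊆
      D.rootedSet A B (reverseOn (D.cut (D.rootedSet A B φ)ᶜ) φ) := by
  suffices h : D.rootedSet A B φ ⊆ D.rootedSet A B φ ∩
      D.rootedSet A B (reverseOn (D.cut (D.rootedSet A B φ)ᶜ) φ) from
    h.trans Set.inter_subset_right
  refine rootedSet_subset (fun v => ⟨root_mem_rootedSet v, root_mem_rootedSet v⟩)
    (fun u v huv => and_congr (mem_rootedSet_iff_of_mem huv) (mem_rootedSet_iff_of_mem huv))
    fun a ha ⟨hsrc, hsrc'⟩ => ?_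
  have htgt := tgt_mem_rootedSet ha hsrc
  refine ⟨htgt, tgt_mem_rootedSet ?_ hsrc'⟩
  rw [mem_arcs, cut_compl, reverseOn_of_notMem]
  · exact ha
  · rw [mem_cut_iff, not_not]
    exact iff_of_true hsrc htgt

theorem exists_cocycleStep_rootedSet_ssubset (hφ : ¬ D.HasZeroWayCocycle A B φ)
    (h : ¬ D.Rooted A B φ) :
    ∃ ψ, D.CocycleStep A B φ ψ ∧ D.rootedSet A B φ ⊂ D.rootedSet A B ψ := by
  have hcut := isABCut_rootedSet h
  have hclosed {a : Arc G} (ha : a ∈ arcs φ) := tgt_mem_rootedSet (D := D) (A := A) (B := B) ha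
  refine ⟨_, ⟨_, hcut, fun a ha => ?_, rfl⟩, ?_⟩
  · simpa only [Set.notMem_compl_iff] using hclosed ha
  obtain ⟨e, he, hzero⟩ : ∃ e ∈ D.cut (D.rootedSet A B φ)ᶜ, φ e ≠ .zeroWay := by
    by_contra! hall
    exact hφ ⟨_, hcut, hall⟩
  obtain ⟨d, hd⟩ := Config.exists_allows hzero
  -- The edge `e` enters the rooted set before the reversal and leaves it after the reversal.
  have hiff : ¬ (D.src (e, d) ∈ D.rootedSet A B φ ↔ D.tgt (e, d) ∈ D.rootedSet A B φ) := by
    rwa [← mem_cut_iff, ← cut_compl]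
  have hsrc : D.src (e, d) ∉ D.rootedSet A B φ := fun hs => hiff (iff_of_true hs (hclosed hd hs))
  have htgt : D.tgt (e, d) ∈ D.rootedSet A B φ := by tauto
  refine (Set.ssubset_iff_of_subset rootedSet_subset_reverseOn).2 ⟨D.src (e, d), ?_, hsrc⟩
  rw [← D.tgt_rev (e, d)]
  refine tgt_mem_rootedSet ?_ (by rw [src_rev]; exact rootedSet_subset_reverseOn htgt)
  rw [mem_arcs, Arc.rev_fst, Arc.rev_snd, reverseOn_of_mem he, Config.allows_reverse, Bool.not_not]
  exact hd

theorem CocycleEquiv.sameUpToReversal (h : D.CocycleEquiv A B φ ψ) : SameUpToReversal φ ψ := by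
  induction h with
  | refl => exact .refl φ
  | tail _ hstep ih => exact ih.trans hstep.sameUpToReversal

theorem exists_cocycleEquiv_rooted [Finite E(G)] (hφ : ¬ D.HasZeroWayCocycle A B φ) :
    ∃ ψ, D.CocycleEquiv A B φ ψ ∧ D.Rooted A B ψ := by
  obtain ⟨ψ, hψ, hmax⟩ := (Set.toFinite {ψ | D.CocycleEquiv A B φ ψ}).exists_maximalFor
    (D.rootedSet A B) _ ⟨φ, ReflTransGen.refl⟩
  refine ⟨ψ, hψ, by_contra fun hroot => ?_⟩
  obtain ⟨χ, hstep, hlt⟩ := exists_cocycleStep_rootedSet_ssubset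
    (hψ.sameUpToReversal.hasZeroWayCocycle_iff.not.2 hφ) hroot
  exact hlt.not_subset (hmax (ReflTransGen.tail hψ hstep) hlt.subset)

end Existence

section Uniqueness

variable {p p' : V(G) → ℤ}

variable (D A B) in
/-- `ψ` is obtained from `φ` by reversals, and along each edge that is not 0-way, `p` decreases by
half the change of sign. If `ψ` is obtained by reversing directed cuts, then such a `p` is the sum
of the indicator functions of the sides of these cuts that can be left but not entered. -/
structure IsPotential (φ ψ : Fourientation G) (p : V(G) → ℤ) : Prop where
  same : SameUpToReversal φ ψ
  pair : ∀ u v, (u, v) ∈ A ∪ B → p u = p v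
  edge : ∀ e, φ e ≠ .zeroWay → (φ e).sign - (ψ e).sign = 2 * D.coboundary p e

theorem IsPotential.zero (φ : Fourientation G) : D.IsPotential A B φ φ 0 :=
  ⟨.refl φ, fun _ _ _ => rfl, fun _ _ => by simp [coboundary]⟩

theorem IsPotential.add (h : D.IsPotential A B φ ψ p) (h' : D.IsPotential A B ψ χ p') :
    D.IsPotential A B φ χ (p + p') where
  same := h.same.trans h'.same
  pair u v huv := by simp only [Pi.add_apply, h.pair u v huv, h'.pair u v huv]
  edge e he := by
    have h₁ := h.edge e he
    have h₂ := h'.edge e ((h.same.eq_zeroWay_iff e).not.2 he)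
    simp only [coboundary, Pi.add_apply] at *
    linarith

theorem IsPotential.neg (h : D.IsPotential A B φ ψ p) : D.IsPotential A B ψ φ (-p) where
  same := h.same.symm
  pair u v huv := by simp only [Pi.neg_apply, h.pair u v huv]
  edge e he := by
    have := h.edge e ((h.same.eq_zeroWay_iff e).not.1 he)
    simp only [coboundary, Pi.neg_apply] at *
    linarith

theorem CocycleStep.exists_isPotential (h : D.CocycleStep A B φ ψ) :
    ∃ p, D.IsPotential A B φ ψ p := by
  classical
  have hsame := h.sameUpToReversal
  obtain ⟨U, ⟨-, hAB⟩, hφ, rfl⟩ := h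
  refine ⟨fun v => if v ∈ U then 1 else 0, hsame, fun u v huv => by simp only [hAB u v huv],
    fun e he => ?_⟩
  by_cases hcut : e ∈ D.cut U
  · rw [reverseOn_of_mem hcut, Config.sign_reverse]
    have hfwd := hφ (e, true)
    have hbwd := hφ (e, false)
    simp only [src_true, tgt_true, src_false, tgt_false] at hfwd hbwd
    by_cases htail : D.tail e ∈ U
    · have hhead : D.head e ∉ U := fun hhead => hcut (iff_of_true htail hhead)
      obtain hc : φ e = .forward := by
        cases hc : φ e <;> simp_all [Config.Allows]
      simp [hc, coboundary, htail, hhead, Config.sign]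
    · have hhead : D.head e ∈ U := by_contra fun hhead => hcut (iff_of_false htail hhead)
      obtain hc : φ e = .backward := by
        cases hc : φ e <;> simp_all [Config.Allows]
      simp [hc, coboundary, htail, hhead, Config.sign]
  · have hiff : D.tail e ∈ U ↔ D.head e ∈ U := not_not.1 hcut
    simp [reverseOn_of_notMem hcut, coboundary, hiff]

theorem CocycleEquiv.exists_isPotential (h : D.CocycleEquiv A B φ ψ) :
    ∃ p, D.IsPotential A B φ ψ p := by
  induction h with
  | refl => exact ⟨0, .zero φ⟩
  | tail _ hstep ih =>
    obtain ⟨p, hp⟩ := ih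
    obtain ⟨p', hp'⟩ := hstep.exists_isPotential
    exact ⟨p + p', hp.add hp'⟩

theorem IsPotential.tgt_le_src (h : D.IsPotential A B φ ψ p) {a : Arc G} (ha : a ∈ arcs φ) :
    p (D.tgt a) ≤ p (D.src a) := by
  have hzero : φ a.1 ≠ .zeroWay := fun h₀ => by simp [h₀] at ha
  have hedge := h.edge a.1 hzero
  have htwo : φ a.1 = .twoWay → p (D.tail a.1) = p (D.head a.1) := fun h₂ => by
    simpa [h₂, (h.same.eq_twoWay_iff _).2 h₂, coboundary, sub_eq_zero] using hedge.symm
  rw [← sub_nonneg, ← sign_mul_coboundary ha htwo]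
  obtain hsame | hrev := h.same a.1
  · have hcob : D.coboundary p a.1 = 0 := by simpa [hsame] using hedge.symm
    rw [hcob, mul_zero]
  · have hcob : D.coboundary p a.1 = (φ a.1).sign := by
      rw [hrev, Config.sign_reverse] at hedge
      linarith
    exact hcob ▸ mul_self_nonneg _

theorem IsPotential.le_root (h : D.IsPotential A B φ ψ p) (hφ : D.Rooted A B φ) (v : V(G)) :
    p v ≤ p (D.root A B v) := by
  have hsub : D.rootedSet A B φ ⊆ {v | p v ≤ p (D.root A B v)} := by
    refine rootedSet_subset (fun v => by simp) (fun u v huv => ?_) fun a ha hsrc => ?_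
    · simp only [Set.mem_ofPred_eq, h.pair u v huv, root_eq_of_mem huv]
    · rw [Set.mem_ofPred_eq, ← root_src]
      exact (h.tgt_le_src ha).trans hsrc
  exact hsub (rooted_iff.1 hφ ▸ Set.mem_univ v)

theorem Rooted.eq_of_cocycleEquiv (hφ : D.Rooted A B φ) (hψ : D.Rooted A B ψ)
    (h : D.CocycleEquiv A B φ ψ) : φ = ψ := by
  obtain ⟨p, hp⟩ := h.exists_isPotential
  have hroot (v : V(G)) : p v = p (D.root A B v) :=
    (hp.le_root hφ v).antisymm (neg_le_neg_iff.1 (hp.neg.le_root hψ v))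
  have hcob (e : E(G)) : D.coboundary p e = 0 := by
    rw [coboundary, hroot, ← D.src_true, root_src, tgt_true, ← hroot, sub_self]
  funext e
  have hedge := hp.edge e
  rw [hcob] at hedge
  obtain hsame | hrev := hp.same e
  · exact hsame.symm
  · rw [hrev] at hedge ⊢
    cases hc : φ e <;> simp_all [Config.sign, Config.reverse]

end Uniqueness

end RefOrientation

/-! ### Counting classes -/

section Classes

variable {X : Type*} {r s : X → X → Prop}

theorem exists_reflTransGen_of_commute (hrs : ∀ x y z, r x y → s y z → ∃ w, s x w ∧ r w z)
    {x y z : X} (hxy : r x y) (hyz : ReflTransGen s y z) : ∃ w, ReflTransGen s x w ∧ r w z := by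
  induction hyz with
  | refl => exact ⟨x, .refl, hxy⟩
  | tail _ hs ih =>
    obtain ⟨w, hxw, hw⟩ := ih
    obtain ⟨w', hww', hw'⟩ := hrs _ _ _ hw hs
    exact ⟨w', hxw.tail hww', hw'⟩

theorem exists_reflTransGen_of_reflTransGen_or
    (hrs : ∀ x y z, r x y → s y z → ∃ w, s x w ∧ r w z) {x z : X}
    (h : ReflTransGen (fun x y => r x y ∨ s x y) x z) :
    ∃ y, ReflTransGen s x y ∧ ReflTransGen r y z := by
  induction h using ReflTransGen.head_induction_on with
  | refl => exact ⟨z, .refl, .refl⟩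
  | head hstep _ ih =>
    obtain ⟨y, hs, hr⟩ := ih
    obtain hstep | hstep := hstep
    · obtain ⟨w, hw, hwy⟩ := exists_reflTransGen_of_commute hrs hstep hs
      exact ⟨w, hw, hr.head hwy⟩
    · exact ⟨y, hs.head hstep, hr⟩

theorem ncard_classes_eq {Q R : X → Prop} (hsymm : ∀ x y, s x y → s y x)
    (hQ : ∀ x y, s x y → Q x → Q y) (hex : ∀ x, Q x → ∃ y, ReflTransGen s x y ∧ R y)
    (huniq : ∀ x y, R x → R y → ReflTransGen s x y → x = y) :
    {C : Set X | (∃ x, C = {y | ReflTransGen s x y}) ∧ ∀ x ∈ C, Q x}.ncard =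
      {x | Q x ∧ R x}.ncard := by
  have hsymm' {x y} (h : ReflTransGen s x y) : ReflTransGen s y x :=
    reflTransGen_swap.1 (ReflTransGen.mono hsymm _ _ h)
  have hQ' {x y} (h : ReflTransGen s x y) (hx : Q x) : Q y := by
    induction h with
    | refl => exact hx
    | tail _ h ih => exact hQ _ _ h ih
  have himage : {C : Set X | (∃ x, C = {y | ReflTransGen s x y}) ∧ ∀ x ∈ C, Q x} =
      (fun x => {y | ReflTransGen s x y}) '' {x | Q x ∧ R x} := by
    ext C
    constructor
    · rintro ⟨⟨x, rfl⟩, hx⟩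
      obtain ⟨y, hxy, hy⟩ := hex x (hx x .refl)
      exact ⟨y, ⟨hx y hxy, hy⟩, Set.ext fun z => ⟨hxy.trans, (hsymm' hxy).trans⟩⟩
    · rintro ⟨x, ⟨hx, -⟩, rfl⟩
      exact ⟨⟨x, rfl⟩, fun y hy => hQ' hy hx⟩
  rw [himage, Set.InjOn.ncard_image]
  rintro x ⟨-, hx⟩ y ⟨-, hy⟩ hxy
  exact huniq x y hx hy ((Set.ext_iff.1 hxy y).2 .refl)

end Classes

namespace RefOrientation

variable {D : RefOrientation G} {A B : Set (V(G) × V(G))} {φ ψ : Fourientation G}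

theorem CycleStep.mem_four {S : Set E(G)} (h : D.CycleStep φ ψ) (hφ : φ ∈ D.four A B S) :
    ψ ∈ D.four A B S :=
  ⟨h.valid_iff.2 hφ.1, h.sameUpToReversal.solid_eq.trans hφ.2⟩

theorem CocycleStep.mem_four {S : Set E(G)} (h : D.CocycleStep A B φ ψ)
    (hφ : φ ∈ D.four A B S) : ψ ∈ D.four A B S :=
  ⟨h.valid hφ.1, h.sameUpToReversal.solid_eq.trans hφ.2⟩

theorem union_subset_union_rootArcs : A ∪ B ⊆ ∅ ∪ D.rootArcs A B :=
  fun _ h => .inr (.inl h)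

theorem CycleEquiv.rooted_iff (h : D.CycleEquiv φ ψ) :
    D.Rooted A B ψ ↔ D.Rooted A B φ := by
  induction h with
  | refl => rfl
  | tail _ hstep ih => exact hstep.valid_iff.trans ih

theorem exists_cycleCocycleEquiv [LinearOrder E(G)] [Finite E(G)] (h₂ : ¬ D.HasTwoWayCycle φ)
    (h₀ : ¬ D.HasZeroWayCocycle A B φ) :
    ∃ ψ, D.CycleCocycleEquiv A B φ ψ ∧ D.Rooted A B ψ ∧ D.CycleMinimal ψ := by
  obtain ⟨χ, hχ, hroot⟩ := exists_cocycleEquiv_rooted h₀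
  obtain ⟨ψ, hψ, hmin⟩ :=
    exists_cycleEquiv_cycleMinimal (hχ.sameUpToReversal.hasTwoWayCycle_iff.not.2 h₂)
  exact ⟨ψ, (ReflTransGen.mono (fun _ _ => .inr) _ _ hχ).trans
    (ReflTransGen.mono (fun _ _ => .inl) _ _ hψ), hψ.rooted_iff.2 hroot, hmin⟩

theorem CycleCocycleEquiv.exists_cocycleEquiv_cycleEquiv (h : D.CycleCocycleEquiv A B φ ψ) :
    ∃ χ, D.CocycleEquiv A B φ χ ∧ D.CycleEquiv χ ψ := by
  refine exists_reflTransGen_of_reflTransGen_or (fun x y z hxy hyz => ?_) h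
  obtain ⟨w, hxw, hzw⟩ := hxy.symm.exists_cocycleStep hyz
  exact ⟨w, hxw, hzw.symm⟩

theorem eq_of_cycleCocycleEquiv [LinearOrder E(G)] [Finite E(G)]
    (hφ : D.Rooted A B φ ∧ D.CycleMinimal φ) (hψ : D.Rooted A B ψ ∧ D.CycleMinimal ψ)
    (h : D.CycleCocycleEquiv A B φ ψ) : φ = ψ := by
  obtain ⟨χ, hφχ, hχψ⟩ := h.exists_cocycleEquiv_cycleEquiv
  obtain rfl := hφ.1.eq_of_cocycleEquiv (hχψ.rooted_iff.1 hψ.1) hφχ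
  exact hφ.2.eq_of_cycleEquiv hψ.2 hχψ

section Counting

variable (D A B) [Finite E(G)] (S : Set E(G))

theorem ncard_cycClasses [LinearOrder E(G)] :
    (D.cycClasses A B S).ncard =
      {φ | solid φ = S ∧ D.Valid A B φ ∧ D.CycleMinimal φ}.ncard := by
  have hrep : {φ | solid φ = S ∧ D.Valid A B φ ∧ D.CycleMinimal φ} =
      {φ | (φ ∈ D.four A B S ∧ ¬ D.HasTwoWayCycle φ) ∧ D.CycleMinimal φ} := by
    ext φ
    have : D.CycleMinimal φ → ¬ D.HasTwoWayCycle φ := And.left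
    simp only [four, Set.mem_ofPred_eq]
    tauto
  rw [hrep]
  exact ncard_classes_eq (fun _ _ => CycleStep.symm)
    (fun _ _ h hφ => ⟨h.mem_four hφ.1, h.sameUpToReversal.hasTwoWayCycle_iff.not.2 hφ.2⟩)
    (fun _ hφ => exists_cycleEquiv_cycleMinimal hφ.2)
    (fun _ _ => CycleMinimal.eq_of_cycleEquiv)

theorem ncard_cocClasses :
    (D.cocClasses A B S).ncard =
      {φ | solid φ = S ∧ D.Valid A B φ ∧ D.Rooted A B φ}.ncard := by
  have hrep : {φ | solid φ = S ∧ D.Valid A B φ ∧ D.Rooted A B φ} =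
      {φ | (φ ∈ D.four A B S ∧ ¬ D.HasZeroWayCocycle A B φ) ∧ D.Rooted A B φ} := by
    ext φ
    have : D.Rooted A B φ → ¬ D.HasZeroWayCocycle A B φ := Rooted.not_hasZeroWayCocycle
    simp only [four, Set.mem_ofPred_eq]
    tauto
  rw [hrep]
  exact ncard_classes_eq (fun _ _ => CocycleStep.symm)
    (fun _ _ h hφ => ⟨h.mem_four hφ.1, h.sameUpToReversal.hasZeroWayCocycle_iff.not.2 hφ.2⟩)
    (fun _ hφ => exists_cocycleEquiv_rooted hφ.2)
    (fun _ _ => Rooted.eq_of_cocycleEquiv)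

theorem ncard_ccClasses [LinearOrder E(G)] :
    (D.ccClasses A B S).ncard =
      {φ | solid φ = S ∧ (D.Valid A B φ ∧ D.Rooted A B φ) ∧ D.CycleMinimal φ}.ncard := by
  have hrep : {φ | solid φ = S ∧ (D.Valid A B φ ∧ D.Rooted A B φ) ∧ D.CycleMinimal φ} =
      {φ | (φ ∈ D.four A B S ∧ ¬ D.HasTwoWayCycle φ ∧ ¬ D.HasZeroWayCocycle A B φ) ∧
        D.Rooted A B φ ∧ D.CycleMinimal φ} := by
    ext φ
    have : D.CycleMinimal φ → ¬ D.HasTwoWayCycle φ := And.left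
    have : D.Rooted A B φ → ¬ D.HasZeroWayCocycle A B φ := Rooted.not_hasZeroWayCocycle
    simp only [four, Set.mem_ofPred_eq]
    tauto
  rw [hrep]
  refine ncard_classes_eq (fun _ _ h => h.imp (·.symm) (·.symm)) ?_
    (fun _ hφ => exists_cycleCocycleEquiv hφ.2.1 hφ.2.2)
    (fun _ _ => eq_of_cycleCocycleEquiv)
  rintro φ ψ h ⟨hφ, h₂, h₀⟩
  have hrev : SameUpToReversal φ ψ := h.elim (·.sameUpToReversal) (·.sameUpToReversal)
  exact ⟨h.elim (·.mem_four hφ) (·.mem_four hφ), hrev.hasTwoWayCycle_iff.not.2 h₂,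
    hrev.hasZeroWayCocycle_iff.not.2 h₀⟩

end Counting

section Independence

variable (D A B) [Finite E(G)] (S : Set E(G)) (e : E(G))

theorem ncard_cycClasses_symmDiff :
    (D.cycClasses A B S).ncard = (D.cycClasses A B (symmDiff S {e})).ncard := by
  obtain ⟨_, he⟩ := exists_linearOrder_isTop e
  rw [ncard_cycClasses, ncard_cycClasses]
  refine ncard_solid_symmDiff (fun φ hφ => ?_) S
  obtain ⟨d, ⟨hvalid, -⟩, hmin⟩ :=
    exists_toggleInvariant_valid_cycleMinimal (D := D) (subset_refl (A ∪ B)) he hφ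
  exact ⟨d, hvalid.and hmin⟩

theorem ncard_cocClasses_symmDiff :
    (D.cocClasses A B S).ncard = (D.cocClasses A B (symmDiff S {e})).ncard := by
  classical
  rw [ncard_cocClasses, ncard_cocClasses]
  refine ncard_solid_symmDiff (fun φ hφ => ?_) S
  obtain ⟨d, hvalid, hroot⟩ :=
    exists_toggleInvariant_valid (D := D) (union_subset_union_rootArcs (D := D)) hφ
  exact ⟨d, hvalid.and hroot⟩

theorem ncard_ccClasses_symmDiff :
    (D.ccClasses A B S).ncard = (D.ccClasses A B (symmDiff S {e})).ncard := by
  obtain ⟨_, he⟩ := exists_linearOrder_isTop e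
  rw [ncard_ccClasses, ncard_ccClasses]
  refine ncard_solid_symmDiff (fun φ hφ => ?_) S
  obtain ⟨d, ⟨hvalid, hroot⟩, hmin⟩ :=
    exists_toggleInvariant_valid_cycleMinimal (D := D) (union_subset_union_rootArcs (D := D)) he hφ
  exact ⟨d, (hvalid.and hroot).and hmin⟩

end Independence

end RefOrientation

end Fourient

open Fourient RefOrientation in
theorem theorem4_general {α β : Type*} (G : Graph α β) [Finite E(G)]
    (D : Fourient.RefOrientation G) (A B : Set (V(G) × V(G))) :
    (∀ S S' : Set E(G), (D.cycClasses A B S).ncard = (D.cycClasses A B S').ncard) ∧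
    (∀ S S' : Set E(G), (D.cocClasses A B S).ncard = (D.cocClasses A B S').ncard) ∧
    (∀ S S' : Set E(G), (D.ccClasses A B S).ncard = (D.ccClasses A B S').ncard) :=
  ⟨eq_of_eq_symmDiff_singleton (ncard_cycClasses_symmDiff D A B),
    eq_of_eq_symmDiff_singleton (ncard_cocClasses_symmDiff D A B),
    eq_of_eq_symmDiff_singleton (ncard_ccClasses_symmDiff D A B)⟩

theorem theorem4 {α β : Type*} (G : Graph α β) [Finite V(G)] [Finite E(G)]
    (D : Fourient.RefOrientation G) (A B : Set (V(G) × V(G))) :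
    (∀ S S' : Set E(G), (D.cycClasses A B S).ncard = (D.cycClasses A B S').ncard) ∧
    (∀ S S' : Set E(G), (D.cocClasses A B S).ncard = (D.cocClasses A B S').ncard) ∧
    (∀ S S' : Set E(G), (D.ccClasses A B S).ncard = (D.ccClasses A B S').ncard) :=
  theorem4_general G D A B
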